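/- Fix $\omega_0,\epsilon_F>0$. For $T>0$ let $f(x)=1/(e^x+1)$, $n(x)=1/(e^x-1)$, $w(\epsilon)=f(\epsilon/T)\,[1-f(\epsilon/T)]$, $$\bar K_0(\epsilon,u)=\Big(\frac{T}{\omega_0}\Big)^2\big[n(y)+f(y+\epsilon/T)\big]\,y^2\,\mathrm{sgn}(y),\qquad y=\frac{u-\epsilon}{T},$$ $$\bar K_1(\epsilon,u)=\frac{u-\epsilon}{2\epsilon_F}\,\bar K_0(\epsilon,u),\qquad \bar K_2(\epsilon,u)=\frac{(u-\epsilon)^2}{2\omega_0^2}\,\bar K_0(\epsilon,u),$$ $\Gamma_\nu(\epsilon)=\int_{\mathbb R}\bar K_\nu(\epsilon,u)\,du$ and $K_\nu(\epsilon,u)=\bar K_\nu(\epsilon,u)/\Gamma_0(\epsilon)$ for $\nu=0,1,2$. Write $K_\nu$ also for the integral operator $(K_\nu\varphi)(\epsilon)=\int_{\mathbb R}K_\nu(\epsilon,u)\varphi(u)\,du$, let $L^2_\sigma$ be the space of real functions that are square integrable with respect to $d\sigma(\epsilon)=w(\epsilon)\Gamma_0(\epsilon)\,d\epsilon$, with norm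 $\|\cdot\|$, and let $$(\mathcal C_0\varphi)(\epsilon)=\int_{\mathbb R}K_0(\epsilon,u+\epsilon)\,[\varphi(u+\epsilon)-\varphi(\epsilon)]\,du .$$ (All of these depend on $T$.) For families $f_T,g_T\in L^2_\sigma$ say that $f_T=g_T$ to leading order for $T\to0$ if $\|f_T-g_T\|=o(\|g_T\|)$ as $T\to0^+$. 1. For every $T>0$ and every odd $f\in L^2_\sigma$ the Neumann series $\sum_{m\ge0}(K_0)^m f$ converges in $L^2_\sigma$. 2. For every $T>0$ the function $\Gamma_1/\Gamma_0$ is an odd element of $L^2_\sigma$, and so is $S_T=\sum_{m\ge0}(K_0)^m(\Gamma_1/\Gamma_0)$. For every constant $\phi_+\in\mathbb R$, the function $\phi_+S_T$ is the unique odd solution $\varphi_-\in L^2_\sigma$ of the leading-order equation $\mathcal C_0\varphi_-=-K_1\phi_+$. 3. There is $T_0>0$ such that for $0<T<T_0$ the integral equation $$\varphi(\epsilon)=\frac1{\Gamma_0(\epsilon)}+\int_{\mathbb R}\big[K_0+K_1-K_2\big](\epsilon,u)\,\varphi(u)\,du$$ has exactly one solution $\varphi\in L^2_\sigma$. Let $\varphi_\pm(\epsilon)=[\varphi(\epsilon)\pm\varphi(-\epsilon)]/2$.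 To leading order for $T\to0$ the even part is a constant: $\varphi_+=C\,T^{-5}$ to leading order for some constant $C>0$. For every choice of constants $\phi_+=\phi_+(T)$ with $\varphi_+=\phi_+$ to leading order, the odd part is $$\varphi_-=\phi_+\sum_{m=0}^\infty (K_0)^m\,\frac{\Gamma_1}{\Gamma_0}\qquad\text{to leading order for }T\to0 .$$ -/

import Mathlib

open MeasureTheory Filter Topology

namespace ElectronPhonon

noncomputable section

/-- Fermi distribution function. -/
def fermi (x : ℝ) : ℝ := 1 / (Real.exp x + 1)

/-- Bose distribution function. It is only ever multiplied by a function that vanishes to second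
order at `0`, so the value at `0` plays no role. -/
def bose (x : ℝ) : ℝ := 1 / (Real.exp x - 1)

/-- The weight function `w(ε) = f₀(ε/T) (1 - f₀(ε/T))`. -/
def weight (T ε : ℝ) : ℝ := fermi (ε / T) * (1 - fermi (ε / T))

/-- The dimensionless phonon kernel `k̄₀(x, y) = [n(y) + f(y + x)] y² sgn y`. -/
def kbar (x y : ℝ) : ℝ := (bose y + fermi (y + x)) * y ^ 2 * Real.sign y

/-- The kernel `K̄₀(ε, u)`. -/
def Kbar₀ (ω₀ T ε u : ℝ) : ℝ := (T / ω₀) ^ 2 * kbar (ε / T) ((u - ε) / T)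

/-- The kernel `K̄₁(ε, u)`. -/
def Kbar₁ (ω₀ εF T ε u : ℝ) : ℝ :=
  ω₀ / (2 * εF) * (T / ω₀) * ((u - ε) / T) * Kbar₀ ω₀ T ε u

/-- The kernel `K̄₂(ε, u)`. -/
def Kbar₂ (ω₀ T ε u : ℝ) : ℝ :=
  1 / 2 * (T / ω₀) ^ 2 * ((u - ε) / T) ^ 2 * Kbar₀ ω₀ T ε u

/-- The single-particle rate `Γ₀(ε) = ∫ du K̄₀(ε, u)`. -/
def Γ₀ (ω₀ T ε : ℝ) : ℝ := ∫ u, Kbar₀ ω₀ T ε u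

/-- The rate `Γ₁(ε) = ∫ du K̄₁(ε, u)`. -/
def Γ₁ (ω₀ εF T ε : ℝ) : ℝ := ∫ u, Kbar₁ ω₀ εF T ε u

/-- The kernels `K_ν = K̄_ν / Γ₀(ε)`, `ν = 0, 1, 2`. -/
def K₀ (ω₀ T ε u : ℝ) : ℝ := Kbar₀ ω₀ T ε u / Γ₀ ω₀ T ε

/-- See `K₀`. -/
def K₁ (ω₀ εF T ε u : ℝ) : ℝ := Kbar₁ ω₀ εF T ε u / Γ₀ ω₀ T ε

/-- See `K₀`. -/
def K₂ (ω₀ T ε u : ℝ) : ℝ := Kbar₂ ω₀ T ε u / Γ₀ ω₀ T ε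

/-- The full kernel `K = K₀ + K₁ - K₂`. -/
def Kfull (ω₀ εF T ε u : ℝ) : ℝ := K₀ ω₀ T ε u + K₁ ω₀ εF T ε u - K₂ ω₀ T ε u

/-- The integral operator with kernel `k`: `(k φ)(ε) = ∫ du k(ε, u) φ(u)`. -/
def intOp (k : ℝ → ℝ → ℝ) (φ : ℝ → ℝ) (ε : ℝ) : ℝ := ∫ u, k ε u * φ u

/-- The measure `dσ(ε) = w(ε) Γ₀(ε) dε`; `L²_σ` is the set of functions `φ` with
`MemLp φ 2 (σ ω₀ T)`, taken up to almost everywhere equality. -/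
def σ (ω₀ T : ℝ) : Measure ℝ :=
  volume.withDensity fun ε => ENNReal.ofReal (weight T ε * Γ₀ ω₀ T ε)

/-- The collision operator
`(C₀ φ)(ε) = ∫ du K₀(ε, u + ε) [φ(u + ε) - φ(ε)]`. -/
def C₀ (ω₀ T : ℝ) (φ : ℝ → ℝ) (ε : ℝ) : ℝ :=
  ∫ u, K₀ ω₀ T ε (u + ε) * (φ (u + ε) - φ ε)

/-- `φ ∈ L²_σ` solves the integral equation `φ(ε) = 1/Γ₀(ε) + ∫ du K(ε, u) φ(u)`. -/
def IsSolution (ω₀ εF T : ℝ) (φ : ℝ → ℝ) : Prop :=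
  MemLp φ 2 (σ ω₀ T) ∧
    ∀ᵐ ε, φ ε = 1 / Γ₀ ω₀ T ε + intOp (Kfull ω₀ εF T) φ ε

/-- Even part of a function. -/
def evenPart (φ : ℝ → ℝ) (ε : ℝ) : ℝ := (φ ε + φ (-ε)) / 2

/-- Odd part of a function. -/
def oddPart (φ : ℝ → ℝ) (ε : ℝ) : ℝ := (φ ε - φ (-ε)) / 2

/-- `φ` is an odd element of `L²_σ`. -/
def IsOddL2 (ω₀ T : ℝ) (φ : ℝ → ℝ) : Prop :=
  MemLp φ 2 (σ ω₀ T) ∧ ∀ᵐ ε, φ (-ε) = -φ ε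

/-- `∑_{m ≥ 0} (K₀)^m f = S` in `L²_σ`: all terms and the sum lie in `L²_σ`, and the partial sums
converge to `S` in norm. -/
def HasNeumannSum (ω₀ T : ℝ) (f S : ℝ → ℝ) : Prop :=
  (∀ m : ℕ, MemLp ((intOp (K₀ ω₀ T))^[m] f) 2 (σ ω₀ T)) ∧
  MemLp S 2 (σ ω₀ T) ∧
  Tendsto (fun N : ℕ =>
      eLpNorm (fun ε => (∑ m ∈ Finset.range N, (intOp (K₀ ω₀ T))^[m] f ε) - S ε) 2 (σ ω₀ T))
    atTop (𝓝 0)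

/-- `f_T = g_T` to leading order for `T → 0`: the error `‖f_T - g_T‖` is `o(‖g_T‖)` as `T → 0+`,
in the norm of `L²_σ` (which depends on `T`). -/
def LeadingOrder (ω₀ : ℝ) (f g : ℝ → ℝ → ℝ) : Prop :=
  ∀ δ : ℝ, 0 < δ → ∀ᶠ T in 𝓝[>] (0 : ℝ),
    eLpNorm (fun ε => f T ε - g T ε) 2 (σ ω₀ T) ≤
      ENNReal.ofReal δ * eLpNorm (g T) 2 (σ ω₀ T)

end

end ElectronPhonon

open ElectronPhonon

/-
In the variables `x = ε / T`, `z = u / T`, detailed balance turns `K₀` into a symmetric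
Hilbert-Schmidt Markov operator `K` on `L²` of a fixed finite measure. Its kernel is positive, so
`‖K x‖ = ‖x‖` only for constants, and by compactness `K` has a spectral gap: it is a strict
contraction on the orthogonal complement of the constants, which contains all odd functions. There
the Neumann series converges and inverts `1 - K`.

In the same variables `K₁` and `K₂` become `T A` and `T² B`, where `A` is antisymmetric and reverses
parity and `B` preserves it, and the integral equation reads `(1 - K - T A + T² B) x = T⁻³ q`. Since
`⟪x, A x⟫ = 0`, the quadratic form of the left-hand side is bounded below by the gap off the
constants and by `T² ⟪1, B 1⟫` on them, so the equation is uniquely solvable for small `T`.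
Expanding the solution as `C T⁻⁵ (1 + T o + T² e) + O(T⁻³)`, the first order gives
`o = ∑ Kᵐ A 1`, and solvability of the second order fixes `C`.
-/

namespace ElectronPhonon

noncomputable section

open scoped RealInnerProductSpace ENNReal Asymptotics

/-! ### Spectral gaps of compact operators -/

section CompactOperators

open ContinuousLinearMap Module.End

variable {𝕜 E F : Type*} [RCLike 𝕜] [NormedAddCommGroup E] [InnerProductSpace 𝕜 E]
  [CompleteSpace E] [NormedAddCommGroup F] [InnerProductSpace 𝕜 F] [CompleteSpace F]

theorem norm_adjoint_comp_self_sub_sq_le {T : E →L[𝕜] F} (hT : ‖T‖ ≤ 1) (x : E) :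
    ‖adjoint T (T x) - x‖ ^ 2 ≤ ‖x‖ ^ 2 - ‖T x‖ ^ 2 := by
  have hadj : ‖adjoint T (T x)‖ ≤ ‖T x‖ := by
    refine ((adjoint T).le_of_opNorm_le ?_ _).trans_eq (one_mul _)
    rwa [LinearIsometryEquiv.norm_map]
  have hinner : RCLike.re (inner 𝕜 (adjoint T (T x)) x) = ‖T x‖ ^ 2 := by
    rw [adjoint_inner_left, inner_self_eq_norm_sq]
  rw [@norm_sub_sq 𝕜, hinner]
  nlinarith [norm_nonneg (adjoint T (T x)), norm_nonneg (T x)]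

theorem opNorm_lt_one_of_isCompactOperator {T : E →L[𝕜] F} (hT : IsCompactOperator T)
    (hlt : ∀ x ≠ 0, ‖T x‖ < ‖x‖) : ‖T‖ < 1 := by
  have hle (x : E) : ‖T x‖ ≤ 1 * ‖x‖ := by
    rcases eq_or_ne x 0 with rfl | hx
    · simp
    · simpa using (hlt x hx).le
  have hnot : ¬HasEigenvalue (adjoint T ∘L T : E →L[𝕜] E).toLinearMap (1 : 𝕜) := by
    intro h
    obtain ⟨x, hx⟩ := h.exists_hasEigenvector
    have hfix : adjoint T (T x) = x := by simpa using hx.apply_eq_smul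
    have hnorm := apply_norm_sq_eq_inner_adjoint_left T x
    rw [comp_apply, hfix, inner_self_eq_norm_sq] at hnorm
    exact (hlt x hx.2).ne ((sq_eq_sq₀ (norm_nonneg _) (norm_nonneg _)).1 hnorm)
  obtain ⟨c, hc⟩ :=
    (hT.clm_comp (adjoint T)).antilipschitz_of_not_hasEigenvalue one_ne_zero hnot
  have hbound (x : E) : ‖x‖ ^ 2 ≤ (c : ℝ) ^ 2 * (‖x‖ ^ 2 - ‖T x‖ ^ 2) := by
    have h := ContinuousLinearMap.bound_of_antilipschitz _ hc x
    simp only [one_smul, sub_apply, comp_apply] at h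
    calc ‖x‖ ^ 2 ≤ (c * ‖adjoint T (T x) - x‖) ^ 2 := pow_le_pow_left₀ (norm_nonneg x) h 2
      _ ≤ (c : ℝ) ^ 2 * (‖x‖ ^ 2 - ‖T x‖ ^ 2) := by
        rw [mul_pow]
        gcongr
        exact norm_adjoint_comp_self_sub_sq_le (T.opNorm_le_bound zero_le_one hle) x
  have hlt_one : √((c : ℝ) ^ 2 / (c ^ 2 + 1)) < 1 := by
    rw [Real.sqrt_lt' one_pos, one_pow, div_lt_one (by positivity)]
    linarith
  refine (T.opNorm_le_bound (Real.sqrt_nonneg _) fun x => ?_).trans_lt hlt_one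
  rw [← Real.sqrt_sq (norm_nonneg x), ← Real.sqrt_mul (by positivity)]
  refine Real.le_sqrt_of_sq_le ?_
  rw [div_mul_eq_mul_div, le_div_iff₀ (by positivity)]
  have hsq := pow_le_pow_left₀ (norm_nonneg _) (hle x) 2
  linarith [hbound x]

end CompactOperators

/-! ### Asymptotically equivalent multiples of a vector -/

section Equivalence

variable {ι E : Type*} [NormedAddCommGroup E] [NormedSpace ℝ E] {l : Filter ι} {w : E}
  {c p : ι → ℝ}

theorem isEquivalent_smul_of_norm_sub_le (hw : w ≠ 0) (hc : Tendsto c l atTop) {f : ι → E} (M : ℝ)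
    (h : ∀ᶠ i in l, ‖f i - c i • w‖ ≤ M) : f ~[l] fun i => c i • w := by
  have hbounded : (fun i => f i - c i • w) =O[l] fun _ => (1 : ℝ) :=
    .of_bound M (by simpa using h)
  refine hbounded.trans_isLittleO ((Asymptotics.isLittleO_one_left_iff ℝ).2 ?_)
  simp only [norm_smul]
  exact (tendsto_norm_atTop_atTop.comp hc).atTop_mul_const (norm_pos_iff.2 hw)

theorem isEquivalent_smul_const_iff (hw : w ≠ 0) :
    (fun i => c i • w) ~[l] (fun i => p i • w) ↔ c ~[l] p := by
  simp only [Asymptotics.IsEquivalent, Asymptotics.isLittleO_iff, Pi.sub_apply, ← sub_smul,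
    norm_smul, ← mul_assoc, mul_le_mul_iff_left₀ (norm_pos_iff.2 hw)]

end Equivalence

/-! ### The low-temperature problem in a Hilbert space -/

/-- A symmetric operator `K` that fixes `v` and is a strict contraction on the orthogonal
complement of `v`. -/
structure GappedOperator (H : Type*) [NormedAddCommGroup H] [InnerProductSpace ℝ H] where
  K : H →L[ℝ] H
  v : H
  K_symm : ∀ x y, ⟪K x, y⟫ = ⟪x, K y⟫
  K_v : K v = v
  gap : ‖K ∘L (ℝ ∙ v)ᗮ.subtypeL‖ < 1

namespace GappedOperator

variable {H : Type*} [NormedAddCommGroup H] [InnerProductSpace ℝ H] (m : GappedOperator H)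

/-- The contraction factor of `K` on the orthogonal complement of `v`. -/
def rate : ℝ := ‖m.K ∘L (ℝ ∙ m.v)ᗮ.subtypeL‖

theorem rate_nonneg : 0 ≤ m.rate := by
  rw [rate]; positivity

theorem rate_lt_one : m.rate < 1 := m.gap

theorem inner_v_K (x : H) : ⟪m.v, m.K x⟫ = ⟪m.v, x⟫ := by
  rw [← m.K_symm, m.K_v]

theorem norm_K_le {x : H} (hx : ⟪m.v, x⟫ = 0) : ‖m.K x‖ ≤ m.rate * ‖x‖ :=
  (m.K ∘L (ℝ ∙ m.v)ᗮ.subtypeL).le_opNorm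
    ⟨x, Submodule.mem_orthogonal_singleton_iff_inner_right.2 hx⟩

theorem inner_v_pow {x : H} (hx : ⟪m.v, x⟫ = 0) (n : ℕ) : ⟪m.v, (m.K ^ n) x⟫ = 0 := by
  induction n with
  | zero => simpa using hx
  | succ n ih => rw [pow_succ', mul_apply_eq_comp, m.inner_v_K, ih]

theorem norm_pow_le {x : H} (hx : ⟪m.v, x⟫ = 0) (n : ℕ) : ‖(m.K ^ n) x‖ ≤ m.rate ^ n * ‖x‖ := by
  induction n with
  | zero => simp
  | succ n ih =>
    calc ‖(m.K ^ (n + 1)) x‖ = ‖m.K ((m.K ^ n) x)‖ := by rw [pow_succ', mul_apply_eq_comp]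
      _ ≤ m.rate * ‖(m.K ^ n) x‖ := m.norm_K_le (m.inner_v_pow hx n)
      _ ≤ m.rate * (m.rate ^ n * ‖x‖) := mul_le_mul_of_nonneg_left ih m.rate_nonneg
      _ = m.rate ^ (n + 1) * ‖x‖ := by ring

theorem coercive_of_inner_eq_zero {x : H} (hx : ⟪m.v, x⟫ = 0) :
    (1 - m.rate) * ‖x‖ ^ 2 ≤ ⟪x, x - m.K x⟫ := by
  rw [inner_sub_right, real_inner_self_eq_norm_sq]
  have hinner := real_inner_le_norm x (m.K x)
  have hK := mul_le_mul_of_nonneg_left (m.norm_K_le hx) (norm_nonneg x)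
  linarith

/-- The Neumann series `∑ Kⁿ x`; it converges for `x` orthogonal to `v`. -/
def neumann (x : H) : H := ∑' n, (m.K ^ n) x

theorem neumann_smul (c : ℝ) (x : H) : m.neumann (c • x) = c • m.neumann x := by
  simp only [neumann, map_smul, tsum_const_smul'']

theorem neumann_neg (x : H) : m.neumann (-x) = -m.neumann x := by
  simp only [neumann, map_neg, tsum_neg]

variable [CompleteSpace H] {x y : H}

theorem hasSum_neumann (hx : ⟪m.v, x⟫ = 0) : HasSum (fun n => (m.K ^ n) x) (m.neumann x) :=
  (Summable.of_norm_bounded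
    ((summable_geometric_of_lt_one m.rate_nonneg m.rate_lt_one).mul_right ‖x‖)
    (m.norm_pow_le hx)).hasSum

theorem neumann_sub_K_neumann (hx : ⟪m.v, x⟫ = 0) : m.neumann x - m.K (m.neumann x) = x := by
  have htail : HasSum (fun n => (m.K ^ (n + 1)) x) (m.K (m.neumann x)) := by
    simpa only [pow_succ', mul_apply_eq_comp] using (m.hasSum_neumann hx).mapL m.K
  have hsum := htail.unique ((hasSum_nat_add_iff' 1).2 (m.hasSum_neumann hx))
  simp [hsum]

theorem inner_v_neumann (hx : ⟪m.v, x⟫ = 0) : ⟪m.v, m.neumann x⟫ = 0 := by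
  have h := (m.hasSum_neumann hx).mapL (innerSL ℝ m.v)
  simp only [innerSL_apply_apply, m.inner_v_pow hx] at h
  exact h.unique hasSum_zero

theorem sub_K_eq_iff (hx : ⟪m.v, x⟫ = 0) (hy : ⟪m.v, y⟫ = 0) :
    y - m.K y = x ↔ y = m.neumann x := by
  refine ⟨fun h => ?_, fun h => h ▸ m.neumann_sub_K_neumann hx⟩
  set d := y - m.neumann x with hd
  have hdv : ⟪m.v, d⟫ = 0 := by rw [hd, inner_sub_right, hy, m.inner_v_neumann hx, sub_zero]
  have hdK : d - m.K d = 0 := by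
    rw [hd, map_sub, sub_sub_sub_comm, h, m.neumann_sub_K_neumann hx, sub_self]
  have hcoercive := m.coercive_of_inner_eq_zero hdv
  rw [hdK, inner_zero_right] at hcoercive
  have hnorm : ‖d‖ ^ 2 = 0 :=
    le_antisymm (nonpos_of_mul_nonpos_right hcoercive (sub_pos.2 m.rate_lt_one)) (sq_nonneg _)
  exact sub_eq_zero.1 (norm_eq_zero.1 (pow_eq_zero_iff two_ne_zero |>.1 hnorm))

end GappedOperator

/-- The data of the low-temperature equation `(1 - K - T A + T² B) x = q`: the gapped symmetric
operator `K`, an antisymmetric operator `A` that reverses the parity `N`, and an operator `B` that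
preserves it and is positive in the direction of the fixed vector `v` of `K`. -/
structure LowTemperatureModel (H : Type*) [NormedAddCommGroup H] [InnerProductSpace ℝ H]
    extends GappedOperator H where
  A : H →L[ℝ] H
  B : H →L[ℝ] H
  N : H →ₗᵢ[ℝ] H
  q : H
  A_antisymm : ∀ x y, ⟪A x, y⟫ = -⟪x, A y⟫
  N_K : ∀ x, N (K x) = K (N x)
  N_A : ∀ x, N (A x) = -A (N x)
  N_B : ∀ x, N (B x) = B (N x)
  N_v : N v = v
  N_q : N q = q
  B_pos : 0 < ⟪v, B v⟫
  q_pos : 0 < ⟪v, q⟫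

namespace LowTemperatureModel

variable {H : Type*} [NormedAddCommGroup H] [InnerProductSpace ℝ H] (m : LowTemperatureModel H)

theorem inner_v_eq_zero_of_odd {x : H} (hx : m.N x = -x) : ⟪m.v, x⟫ = 0 := by
  have h := m.N.inner_map_map m.v x
  rw [hx, m.N_v, inner_neg_right] at h
  linarith

theorem N_A_v : m.N (m.A m.v) = -m.A m.v := by rw [m.N_A, m.N_v]

theorem inner_v_A_v : ⟪m.v, m.A m.v⟫ = 0 := m.inner_v_eq_zero_of_odd m.N_A_v

theorem inner_self_A (x : H) : ⟪x, m.A x⟫ = 0 := by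
  have h := m.A_antisymm x x
  rw [real_inner_comm] at h
  linarith

theorem v_ne_zero : m.v ≠ 0 := by
  intro h
  simpa [h] using m.B_pos

theorem exists_eq_smul_v_add (x : H) : ∃ (a : ℝ) (y : H), ⟪m.v, y⟫ = 0 ∧ x = a • m.v + y := by
  refine ⟨⟪m.v, x⟫ / ‖m.v‖ ^ 2, x - (⟪m.v, x⟫ / ‖m.v‖ ^ 2) • m.v, ?_, by abel⟩
  have hv : ‖m.v‖ ^ 2 ≠ 0 := pow_ne_zero _ (norm_ne_zero_iff.2 m.v_ne_zero)
  rw [inner_sub_right, inner_smul_right, real_inner_self_eq_norm_sq, div_mul_cancel₀ _ hv,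
    sub_self]

/-- The operator `1 - K - T A + T² B`. -/
def pencil (T : ℝ) : H →L[ℝ] H :=
  ContinuousLinearMap.id ℝ H - m.K - T • m.A + T ^ 2 • m.B

theorem pencil_apply (T : ℝ) (x : H) :
    m.pencil T x = x - m.K x - T • m.A x + T ^ 2 • m.B x := rfl

theorem exists_le_inner_B :
    ∃ D : ℝ, ∀ (a : ℝ) (x : H), a ^ 2 * ⟪m.v, m.B m.v⟫ / 2 - D * ‖x‖ ^ 2 ≤
      ⟪a • m.v + x, m.B (a • m.v + x)⟫ := by
  set b := ⟪m.v, m.B m.v⟫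
  have hb : 0 < b := m.B_pos
  refine ⟨2 * (‖m.B‖ * ‖m.v‖) ^ 2 / b + ‖m.B‖, fun a x => ?_⟩
  have hinner (y z : H) : |⟪y, m.B z⟫| ≤ ‖m.B‖ * (‖y‖ * ‖z‖) := by
    calc |⟪y, m.B z⟫| ≤ ‖y‖ * ‖m.B z‖ := abs_real_inner_le_norm _ _
      _ ≤ ‖y‖ * (‖m.B‖ * ‖z‖) := by gcongr; exact m.B.le_opNorm z
      _ = ‖m.B‖ * (‖y‖ * ‖z‖) := by ring
  have hcross : -(|a| * (2 * (‖m.B‖ * ‖m.v‖ * ‖x‖))) ≤ a * (⟪m.v, m.B x⟫ + ⟪x, m.B m.v⟫) := by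
    refine (abs_le.1 ?_).1
    rw [abs_mul]
    refine mul_le_mul_of_nonneg_left ((abs_add_le _ _).trans ?_) (abs_nonneg a)
    linarith [hinner m.v x, hinner x m.v]
  have hyoung : |a| * (2 * (‖m.B‖ * ‖m.v‖ * ‖x‖)) ≤
      a ^ 2 * b / 2 + 2 * (‖m.B‖ * ‖m.v‖) ^ 2 / b * ‖x‖ ^ 2 := by
    have hsq : 0 ≤ (|a| * b - 2 * (‖m.B‖ * ‖m.v‖ * ‖x‖)) ^ 2 / (2 * b) := by positivity
    have hexpand : a ^ 2 * b / 2 + 2 * (‖m.B‖ * ‖m.v‖) ^ 2 / b * ‖x‖ ^ 2 -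
        |a| * (2 * (‖m.B‖ * ‖m.v‖ * ‖x‖)) =
        (|a| * b - 2 * (‖m.B‖ * ‖m.v‖ * ‖x‖)) ^ 2 / (2 * b) := by
      rw [← sq_abs a]; field_simp; ring
    linarith
  have hsplit : ⟪a • m.v + x, m.B (a • m.v + x)⟫ =
      a ^ 2 * b + a * (⟪m.v, m.B x⟫ + ⟪x, m.B m.v⟫) + ⟪x, m.B x⟫ := by
    simp only [map_add, map_smul, inner_add_left, inner_add_right, real_inner_smul_left,
      real_inner_smul_right]
    ring
  linarith [(abs_le.1 (hinner x x)).1]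

theorem inner_pencil_eq (T a : ℝ) {x : H} (hx : ⟪m.v, x⟫ = 0) :
    ⟪a • m.v + x, m.pencil T (a • m.v + x)⟫ =
      ⟪x, x - m.K x⟫ + T ^ 2 * ⟪a • m.v + x, m.B (a • m.v + x)⟫ := by
  have hsub : a • m.v + x - m.K (a • m.v + x) = x - m.K x := by
    rw [map_add, map_smul, m.K_v]; abel
  have hv : ⟪a • m.v + x, x - m.K x⟫ = ⟪x, x - m.K x⟫ := by
    rw [inner_add_left, real_inner_smul_left, inner_sub_right m.v, m.inner_v_K, hx]; ring
  rw [pencil_apply, hsub, inner_add_right, inner_sub_right, real_inner_smul_right,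
    real_inner_smul_right, m.inner_self_A, hv]
  ring

theorem exists_pencil_coercive :
    ∃ κ > 0, ∀ᶠ T in 𝓝[>] (0 : ℝ), ∀ (a : ℝ) (x : H), ⟪m.v, x⟫ = 0 →
      κ * (T ^ 2 * a ^ 2 + ‖x‖ ^ 2) ≤ ⟪a • m.v + x, m.pencil T (a • m.v + x)⟫ := by
  obtain ⟨D, hD⟩ := m.exists_le_inner_B
  have hb := m.B_pos
  have hgap : 0 < 1 - m.rate := sub_pos.2 m.rate_lt_one
  refine ⟨min (⟪m.v, m.B m.v⟫ / 2) ((1 - m.rate) / 2), by positivity, ?_⟩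
  have hsmall : ∀ᶠ T : ℝ in 𝓝[>] 0, T ^ 2 * D < (1 - m.rate) / 2 := by
    have hlim : Tendsto (fun T : ℝ => T ^ 2 * D) (𝓝 0) (𝓝 (0 ^ 2 * D)) :=
      (continuous_id.pow 2 |>.mul_const D).tendsto 0
    refine (hlim.mono_left nhdsWithin_le_nhds).eventually_lt_const ?_
    linarith
  filter_upwards [hsmall] with T hT a x hx
  have hB := mul_le_mul_of_nonneg_left (hD a x) (sq_nonneg T)
  have hDx := mul_le_mul_of_nonneg_right hT.le (sq_nonneg ‖x‖)
  have hκa := mul_le_mul_of_nonneg_right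
    (min_le_left (⟪m.v, m.B m.v⟫ / 2) ((1 - m.rate) / 2)) (by positivity : 0 ≤ T ^ 2 * a ^ 2)
  have hκx := mul_le_mul_of_nonneg_right
    (min_le_right (⟪m.v, m.B m.v⟫ / 2) ((1 - m.rate) / 2)) (sq_nonneg ‖x‖)
  rw [m.inner_pencil_eq T a hx]
  linarith [m.coercive_of_inner_eq_zero hx]

theorem norm_smul_v_add_sq (a : ℝ) {x : H} (hx : ⟪m.v, x⟫ = 0) :
    ‖a • m.v + x‖ ^ 2 = a ^ 2 * ‖m.v‖ ^ 2 + ‖x‖ ^ 2 := by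
  rw [norm_add_sq_real, real_inner_smul_left, hx, norm_smul, mul_pow, Real.norm_eq_abs, sq_abs]
  ring

theorem pencil_bijective [CompleteSpace H] {κ T : ℝ} (hκ : 0 < κ) (hT : 0 < T)
    (hcoercive : ∀ (a : ℝ) (x : H), ⟪m.v, x⟫ = 0 →
      κ * (T ^ 2 * a ^ 2 + ‖x‖ ^ 2) ≤ ⟪a • m.v + x, m.pencil T (a • m.v + x)⟫) :
    Function.Bijective (m.pencil T) := by
  have hv : 0 < ‖m.v‖ := norm_pos_iff.2 m.v_ne_zero
  have hbilin : IsCoercive ((innerSL ℝ).comp (m.pencil T)) := by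
    refine ⟨κ * min (T ^ 2 / ‖m.v‖ ^ 2) 1, by positivity, fun u => ?_⟩
    obtain ⟨a, x, hx, rfl⟩ := m.exists_eq_smul_v_add u
    rw [mul_assoc, mul_assoc, ContinuousLinearMap.comp_apply, innerSL_apply_apply,
      real_inner_comm, ← sq, m.norm_smul_v_add_sq a hx, mul_add]
    refine le_trans ?_ (hcoercive a x hx)
    gcongr κ * (?_ + ?_)
    · calc min (T ^ 2 / ‖m.v‖ ^ 2) 1 * (a ^ 2 * ‖m.v‖ ^ 2)
          ≤ T ^ 2 / ‖m.v‖ ^ 2 * (a ^ 2 * ‖m.v‖ ^ 2) := by gcongr; exact min_le_left _ _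
        _ = T ^ 2 * a ^ 2 := by field_simp
    · exact mul_le_of_le_one_left (sq_nonneg _) (min_le_right _ _)
  have hequiv : (m.pencil T : H → H) = hbilin.continuousLinearEquivOfBilin :=
    funext fun u => ext_inner_right ℝ fun w => by
      rw [hbilin.continuousLinearEquivOfBilin_apply]; simp
  rw [hequiv]
  exact hbilin.continuousLinearEquivOfBilin.bijective

theorem le_of_pencil_coercive {κ T R a : ℝ} {x r : H} (hκ : 0 < κ) (hT : 0 < T) (hR : 0 ≤ R)
    (hrv : |⟪m.v, r⟫| ≤ R * T) (hr : ‖r‖ ≤ R)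
    (hcoercive : κ * (T ^ 2 * a ^ 2 + ‖x‖ ^ 2) ≤ ⟪a • m.v + x, r⟫) :
    T * |a| + ‖x‖ ≤ 2 * R / κ := by
  have hupper : ⟪a • m.v + x, r⟫ ≤ R * (T * |a| + ‖x‖) := by
    have hav : a * ⟪m.v, r⟫ ≤ |a| * (R * T) := by
      refine (le_abs_self _).trans ?_
      rw [abs_mul]
      gcongr
    have hxr : ⟪x, r⟫ ≤ ‖x‖ * R := (real_inner_le_norm _ _).trans (by gcongr)
    rw [inner_add_left, real_inner_smul_left]
    linarith
  have hlower : (T * |a| + ‖x‖) ^ 2 / 2 ≤ T ^ 2 * a ^ 2 + ‖x‖ ^ 2 := by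
    nlinarith [sq_nonneg (T * |a| - ‖x‖), sq_abs a]
  have hn : 0 ≤ T * |a| + ‖x‖ := by positivity
  rw [le_div_iff₀ hκ]
  rcases hn.eq_or_lt with hzero | hpos
  · rw [← hzero]; linarith
  · refine le_of_mul_le_mul_right ?_ hpos
    nlinarith [mul_le_mul_of_nonneg_left hlower hκ.le]

/-- The linear response `∑ Kⁿ A v` to the parity-reversing perturbation. -/
def oddResponse : H := m.neumann (m.A m.v)

/-- The coefficient `C` of the leading term `C T⁻² v` of the solution. It is fixed by the
solvability condition of the second-order equation, see `inner_v_evenSource`. -/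
def leadingCoeff : ℝ := ⟪m.v, m.q⟫ / (⟪m.v, m.B m.v⟫ - ⟪m.v, m.A m.oddResponse⟫)

/-- The source of the even second-order correction. -/
def evenSource : H := (1 / m.leadingCoeff) • m.q + m.A m.oddResponse - m.B m.v

theorem inner_v_evenSource : ⟪m.v, m.evenSource⟫ = 0 := by
  have hq := m.q_pos.ne'
  rw [evenSource, inner_sub_right, inner_add_right, real_inner_smul_right, leadingCoeff,
    one_div_div, div_mul_cancel₀ _ hq]
  ring

section Asymptotics

variable [CompleteSpace H]

theorem N_neumann {x : H} (hx : ⟪m.v, x⟫ = 0) : m.N (m.neumann x) = m.neumann (m.N x) := by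
  have hpow (n : ℕ) : m.N ((m.K ^ n) x) = (m.K ^ n) (m.N x) := by
    induction n with
    | zero => simp
    | succ n ih => simp only [pow_succ', mul_apply_eq_comp, m.N_K, ih]
  have h := (m.hasSum_neumann hx).mapL m.N.toContinuousLinearMap
  simp only [LinearIsometry.coe_toContinuousLinearMap, hpow] at h
  exact h.tsum_eq.symm

theorem oddResponse_sub : m.oddResponse - m.K m.oddResponse = m.A m.v :=
  m.neumann_sub_K_neumann m.inner_v_A_v

theorem N_oddResponse : m.N m.oddResponse = -m.oddResponse := by
  rw [oddResponse, m.N_neumann m.inner_v_A_v, m.N_A_v, m.neumann_neg]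

theorem inner_v_A_oddResponse_nonpos : ⟪m.v, m.A m.oddResponse⟫ ≤ 0 := by
  have hantisymm := m.A_antisymm m.v m.oddResponse
  have hcoercive := m.coercive_of_inner_eq_zero (m.inner_v_eq_zero_of_odd m.N_oddResponse)
  rw [m.oddResponse_sub, real_inner_comm] at hcoercive
  have hrate : 0 ≤ (1 - m.rate) * ‖m.oddResponse‖ ^ 2 :=
    mul_nonneg (sub_nonneg.2 m.rate_lt_one.le) (sq_nonneg _)
  linarith

theorem leadingCoeff_pos : 0 < m.leadingCoeff :=
  div_pos m.q_pos (by linarith [m.B_pos, m.inner_v_A_oddResponse_nonpos])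

theorem N_evenSource : m.N m.evenSource = m.evenSource := by
  rw [evenSource, map_sub, map_add, map_smul, m.N_q, m.N_A, m.N_B, m.N_v, m.N_oddResponse,
    map_neg, neg_neg]

/-- The even second-order correction. -/
def evenCorrection : H := m.neumann m.evenSource

theorem evenCorrection_sub : m.evenCorrection - m.K m.evenCorrection = m.evenSource :=
  m.neumann_sub_K_neumann m.inner_v_evenSource

theorem N_evenCorrection : m.N m.evenCorrection = m.evenCorrection := by
  rw [evenCorrection, m.N_neumann m.inner_v_evenSource, m.N_evenSource]

/-- The expansion of the solution up to second order in `T`. -/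
def approxSolution (T : ℝ) : H :=
  (m.leadingCoeff / T ^ 2) • (m.v + T • m.oddResponse + T ^ 2 • m.evenCorrection)

/-- The odd part of the error of the approximate solution. -/
def oddResidual : H := m.B m.oddResponse - m.A m.evenCorrection

theorem inner_v_oddResidual : ⟪m.v, m.oddResidual⟫ = 0 := by
  apply m.inner_v_eq_zero_of_odd
  rw [oddResidual, map_sub, m.N_B, m.N_A, m.N_oddResponse, m.N_evenCorrection, map_neg]
  abel

/-- The residual `(1 - K - T A + T² B) y - q` of the approximate solution `y`. -/
def residual (T : ℝ) : H :=
  (m.leadingCoeff * T) • m.oddResidual + (m.leadingCoeff * T ^ 2) • m.B m.evenCorrection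

theorem pencil_approxSolution {T : ℝ} (hT : T ≠ 0) :
    m.pencil T (m.approxSolution T) = m.q + m.residual T := by
  have hC := m.leadingCoeff_pos.ne'
  have hexpand : m.pencil T (m.approxSolution T) = (m.leadingCoeff / T ^ 2) •
      ((m.v - m.K m.v) + T • ((m.oddResponse - m.K m.oddResponse) - m.A m.v) +
        T ^ 2 • ((m.evenCorrection - m.K m.evenCorrection) - m.A m.oddResponse + m.B m.v) +
        T ^ 3 • m.oddResidual + T ^ 4 • m.B m.evenCorrection) := by
    rw [approxSolution, pencil_apply, oddResidual]
    simp only [map_add, map_smul]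
    module
  rw [hexpand, m.K_v, m.oddResponse_sub, m.evenCorrection_sub, evenSource, residual]
  match_scalars <;> field_simp <;> ring

theorem exists_residual_bound :
    ∃ R ≥ 0, ∀ T ∈ Set.Ioo (0 : ℝ) 1,
      |⟪m.v, m.residual T⟫| ≤ R * T * T ∧ ‖m.residual T‖ ≤ R * T := by
  have hC := m.leadingCoeff_pos
  set C := m.leadingCoeff with hC_def
  set s := m.oddResidual
  set t := m.B m.evenCorrection with ht
  refine ⟨C * (‖s‖ + (1 + ‖m.v‖) * ‖t‖), by positivity, fun T ⟨hT, hT1⟩ => ⟨?_, ?_⟩⟩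
  · rw [residual, inner_add_right, real_inner_smul_right, real_inner_smul_right,
      m.inner_v_oddResidual, mul_zero, zero_add, abs_mul, ← hC_def, ← ht,
      abs_of_pos (by positivity)]
    calc C * T ^ 2 * |⟪m.v, t⟫| ≤ C * T ^ 2 * (‖m.v‖ * ‖t‖) := by
          gcongr; exact abs_real_inner_le_norm _ _
      _ ≤ C * T ^ 2 * (‖s‖ + (1 + ‖m.v‖) * ‖t‖) := by
          gcongr; nlinarith [norm_nonneg s, norm_nonneg t]
      _ = C * (‖s‖ + (1 + ‖m.v‖) * ‖t‖) * T * T := by ring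
  · calc ‖m.residual T‖ ≤ C * T * ‖s‖ + C * T ^ 2 * ‖t‖ := by
          refine (norm_add_le _ _).trans_eq ?_
          rw [norm_smul, norm_smul, Real.norm_of_nonneg (by positivity),
            Real.norm_of_nonneg (by positivity)]
      _ ≤ C * T * ‖s‖ + C * T * ‖t‖ := by gcongr; nlinarith
      _ ≤ C * (‖s‖ + (1 + ‖m.v‖) * ‖t‖) * T := by
          nlinarith [mul_nonneg (mul_pos hC hT).le (mul_nonneg (norm_nonneg m.v) (norm_nonneg t))]

theorem exists_sub_approxSolution_bound :
    ∃ D ≥ 0, ∀ᶠ T in 𝓝[>] (0 : ℝ), Function.Bijective (m.pencil T) ∧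
      ∀ x, m.pencil T x = m.q → ∃ (a : ℝ) (d : H),
        x = m.approxSolution T + (a • m.v + d) ∧ |a| ≤ D ∧ ‖d‖ ≤ D * T := by
  obtain ⟨κ, hκ, hcoercive⟩ := m.exists_pencil_coercive
  obtain ⟨R, hR, hresidual⟩ := m.exists_residual_bound
  refine ⟨2 * R / κ, by positivity, ?_⟩
  filter_upwards [hcoercive, Ioo_mem_nhdsGT one_pos] with T hco hT01
  have hT := hT01.1
  refine ⟨m.pencil_bijective hκ hT hco, fun x hx => ?_⟩
  obtain ⟨a, d, hd, had⟩ := m.exists_eq_smul_v_add (x - m.approxSolution T)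
  have hpencil : m.pencil T (a • m.v + d) = -m.residual T := by
    rw [← had, map_sub, hx, m.pencil_approxSolution hT.ne']
    abel
  obtain ⟨hrv, hr⟩ := hresidual T hT01
  have hest := m.le_of_pencil_coercive hκ hT (mul_nonneg hR hT.le)
    (by rwa [inner_neg_right, abs_neg]) (by rwa [norm_neg]) (hpencil ▸ hco a d hd)
  rw [← mul_assoc, mul_div_right_comm] at hest
  have hTa : 0 ≤ T * |a| := by positivity
  exact ⟨a, d, by rw [← had]; abel, le_of_mul_le_mul_left (by linarith [norm_nonneg d]) hT,
    by linarith⟩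

theorem low_temperature_asymptotics :
    ∃ M : ℝ, ∀ᶠ T in 𝓝[>] (0 : ℝ), Function.Bijective (m.pencil T) ∧
      ∀ x, m.pencil T x = m.q →
        ‖(1 / 2 : ℝ) • (x + m.N x) - (m.leadingCoeff / T ^ 2) • m.v‖ ≤ M ∧
        ‖(1 / 2 : ℝ) • (x - m.N x) - (m.leadingCoeff / T) • m.oddResponse‖ ≤ M * T := by
  obtain ⟨D, hD, hbound⟩ := m.exists_sub_approxSolution_bound
  have hC := m.leadingCoeff_pos
  refine ⟨m.leadingCoeff * ‖m.evenCorrection‖ + (D * ‖m.v‖ + D), ?_⟩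
  filter_upwards [hbound, Ioo_mem_nhdsGT one_pos] with T ⟨hbij, hsol⟩ ⟨hT, hT1⟩
  refine ⟨hbij, fun x hx => ?_⟩
  obtain ⟨a, d, hxd, ha, hd⟩ := hsol x hx
  have hN : m.N x = (m.leadingCoeff / T ^ 2) •
      (m.v - T • m.oddResponse + T ^ 2 • m.evenCorrection) + (a • m.v + m.N d) := by
    simp only [hxd, approxSolution, map_add, map_smul, m.N_v, m.N_oddResponse, m.N_evenCorrection,
      smul_neg, sub_eq_add_neg]
  constructor
  · have heven : (1 / 2 : ℝ) • (x + m.N x) - (m.leadingCoeff / T ^ 2) • m.v =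
        m.leadingCoeff • m.evenCorrection + (a • m.v + (1 / 2 : ℝ) • (d + m.N d)) := by
      rw [hN, hxd, approxSolution]
      match_scalars <;> field_simp <;> ring
    have hdN : ‖(1 / 2 : ℝ) • (d + m.N d)‖ ≤ D := by
      have := norm_add_le d (m.N d)
      rw [m.N.norm_map] at this
      rw [norm_smul, Real.norm_of_nonneg (by positivity)]
      nlinarith
    rw [heven]
    refine (norm_add_le _ _).trans (add_le_add ?_ ((norm_add_le _ _).trans (add_le_add ?_ hdN)))
    · rw [norm_smul, Real.norm_of_nonneg hC.le]
    · rw [norm_smul, Real.norm_eq_abs]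
      gcongr
  · have hodd : (1 / 2 : ℝ) • (x - m.N x) - (m.leadingCoeff / T) • m.oddResponse =
        (1 / 2 : ℝ) • (d - m.N d) := by
      rw [hN, hxd, approxSolution]
      match_scalars <;> field_simp <;> ring
    have hdN := norm_sub_le d (m.N d)
    rw [m.N.norm_map] at hdN
    rw [hodd, norm_smul, Real.norm_of_nonneg (by positivity)]
    have hM : 0 ≤ m.leadingCoeff * ‖m.evenCorrection‖ + D * ‖m.v‖ := by positivity
    nlinarith

theorem isEquivalent_even {x : ℝ → H} (hx : ∀ᶠ T in 𝓝[>] 0, m.pencil T (x T) = m.q) :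
    (fun T => (1 / 2 : ℝ) • (x T + m.N (x T))) ~[𝓝[>] 0]
      fun T => (m.leadingCoeff / T ^ 2) • m.v := by
  obtain ⟨M, hM⟩ := m.low_temperature_asymptotics
  have hcoeff : Tendsto (fun T : ℝ => m.leadingCoeff / T ^ 2) (𝓝[>] 0) atTop := by
    simpa only [div_eq_mul_inv, inv_pow, Function.comp_def] using
      ((tendsto_pow_atTop two_ne_zero).comp tendsto_inv_nhdsGT_zero).const_mul_atTop
        m.leadingCoeff_pos
  refine isEquivalent_smul_of_norm_sub_le m.v_ne_zero hcoeff M ?_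
  filter_upwards [hM, hx] with T hT hxT
  exact (hT.2 _ hxT).1

theorem isEquivalent_odd (hresponse : m.oddResponse ≠ 0) {x : ℝ → H}
    (hx : ∀ᶠ T in 𝓝[>] 0, m.pencil T (x T) = m.q) :
    (fun T => (1 / 2 : ℝ) • (x T - m.N (x T))) ~[𝓝[>] 0]
      fun T => (m.leadingCoeff / T) • m.oddResponse := by
  obtain ⟨M, hM⟩ := m.low_temperature_asymptotics
  have hcoeff : Tendsto (fun T : ℝ => m.leadingCoeff / T) (𝓝[>] 0) atTop := by
    simpa only [div_eq_mul_inv] using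
      tendsto_inv_nhdsGT_zero.const_mul_atTop m.leadingCoeff_pos
  refine isEquivalent_smul_of_norm_sub_le hresponse hcoeff M ?_
  filter_upwards [hM, hx, Ioo_mem_nhdsGT one_pos] with T hT hxT hT1
  obtain ⟨heven, hodd⟩ := hT.2 _ hxT
  exact hodd.trans (mul_le_of_le_one_right ((norm_nonneg _).trans heven) hT1.2.le)

end Asymptotics

end LowTemperatureModel

/-! ### Hilbert–Schmidt integral operators -/

section HilbertSchmidt

theorem isCompactOperator_sum_inner_smul {H E ι : Type*} [NormedAddCommGroup H]
    [InnerProductSpace ℝ H] [NormedAddCommGroup E] [NormedSpace ℝ E] (s : Finset ι) (b : ι → H)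
    (e : ι → E) :
    IsCompactOperator (∑ i ∈ s, (innerSL ℝ (b i)).smulRight (e i) : H →L[ℝ] E) := by
  suffices (∑ i ∈ s, (innerSL ℝ (b i)).smulRight (e i) : H →L[ℝ] E) ∈
      compactOperator (RingHom.id ℝ) H E from this
  refine Submodule.sum_mem _ fun i _ => ?_
  have hcoord : IsCompactOperator (innerSL ℝ (b i)) :=
    isCompactOperator_of_locallyCompactSpace_dom _
  exact hcoord.clm_comp ((ContinuousLinearMap.id ℝ ℝ).smulRight (e i))

theorem norm_sum_smul_sq_le {E ι : Type*} [SeminormedAddCommGroup E] [NormedSpace ℝ E]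
    (s : Finset ι) (c : ι → ℝ) (e : ι → E) :
    ‖∑ i ∈ s, c i • e i‖ ^ 2 ≤ (∑ i ∈ s, ‖c i‖ ^ 2) * ∑ i ∈ s, ‖e i‖ ^ 2 :=
  calc ‖∑ i ∈ s, c i • e i‖ ^ 2 ≤ (∑ i ∈ s, ‖c i‖ * ‖e i‖) ^ 2 := by
        gcongr
        exact norm_sum_le_of_le _ fun i _ => (norm_smul _ _).le
    _ ≤ _ := Finset.sum_mul_sq_le_sq_mul_sq s _ _

theorem isCompactOperator_of_summable_norm_sq {H E ι : Type*} [NormedAddCommGroup H]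
    [InnerProductSpace ℝ H] [NormedAddCommGroup E] [NormedSpace ℝ E] [CompleteSpace E]
    (T : H →L[ℝ] E) (b : HilbertBasis ι ℝ H) (hT : Summable fun i => ‖T (b i)‖ ^ 2) :
    IsCompactOperator T := by
  classical
  let trunc (s : Finset ι) : H →L[ℝ] E := ∑ i ∈ s, (innerSL ℝ (b i)).smulRight (T (b i))
  refine isCompactOperator_of_tendsto (l := atTop) (F := trunc) ?_
    (Eventually.of_forall fun s => isCompactOperator_sum_inner_smul s _ _)
  rw [Metric.tendsto_atTop]
  intro ε hε
  obtain ⟨s₀, hs₀⟩ := summable_iff_vanishing_norm.1 hT ((ε / 2) ^ 2) (by positivity)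
  refine ⟨s₀, fun s hs => ?_⟩
  rw [dist_comm, dist_eq_norm]
  refine lt_of_le_of_lt (b := ε / 2)
    (ContinuousLinearMap.opNorm_le_bound _ (by positivity) fun φ => ?_) (by linarith)
  have hexpand : HasSum (fun i => ⟪b i, φ⟫ • T (b i)) (T φ) := by
    simpa [b.repr_apply_apply] using (b.hasSum_repr φ).mapL T
  refine le_of_tendsto (hexpand.sub_const (trunc s φ)).norm ?_
  filter_upwards [eventually_ge_atTop s] with t hst
  have hdiff : ∑ i ∈ t, ⟪b i, φ⟫ • T (b i) - trunc s φ = ∑ i ∈ t \ s, ⟪b i, φ⟫ • T (b i) := by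
    rw [← Finset.sum_sdiff hst]
    simp [trunc]
  have htail : ∑ i ∈ t \ s, ‖T (b i)‖ ^ 2 ≤ (ε / 2) ^ 2 :=
    (le_abs_self _).trans (hs₀ (t \ s) (Finset.disjoint_left.2 fun i hi hi' =>
      (Finset.mem_sdiff.1 hi).2 (hs hi'))).le
  rw [hdiff]
  refine (abs_le_of_sq_le_sq' ?_ (by positivity)).2
  calc ‖∑ i ∈ t \ s, ⟪b i, φ⟫ • T (b i)‖ ^ 2
      ≤ (∑ i ∈ t \ s, ‖⟪b i, φ⟫‖ ^ 2) * ∑ i ∈ t \ s, ‖T (b i)‖ ^ 2 := norm_sum_smul_sq_le _ _ _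
    _ ≤ ‖φ‖ ^ 2 * (ε / 2) ^ 2 := by
        gcongr
        exact b.orthonormal.sum_inner_products_le φ
    _ = (ε / 2 * ‖φ‖) ^ 2 := by ring

section Carleman

variable {X H : Type*} [MeasurableSpace X] [NormedAddCommGroup H] [InnerProductSpace ℝ H]
  {k : X → H} {μ : Measure X}

/-- A weakly measurable map `k : X → H` with square integrable norm; it is the kernel of the
Carleman operator `φ ↦ ⟪k ·, φ⟫`. -/
structure IsCarlemanKernel (k : X → H) (μ : Measure X) : Prop where
  aestronglyMeasurable_inner (φ : H) : AEStronglyMeasurable (fun x => ⟪k x, φ⟫) μ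
  integrable_norm_sq : Integrable (fun x => ‖k x‖ ^ 2) μ

theorem norm_sq_eq_integral_sq (f : Lp ℝ 2 μ) : ‖f‖ ^ 2 = ∫ x, f x ^ 2 ∂μ := by
  rw [← real_inner_self_eq_norm_sq, L2.inner_def]
  simp [sq]

theorem real_inner_sq_le (x φ : H) : ⟪x, φ⟫ ^ 2 ≤ ‖x‖ ^ 2 * ‖φ‖ ^ 2 := by
  rw [← sq_abs, ← mul_pow]
  gcongr
  exact abs_real_inner_le_norm _ _

namespace IsCarlemanKernel

theorem integrable_inner_sq (hk : IsCarlemanKernel k μ) (φ : H) :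
    Integrable (fun x => ⟪k x, φ⟫ ^ 2) μ :=
  (hk.integrable_norm_sq.mul_const (‖φ‖ ^ 2)).mono' ((hk.aestronglyMeasurable_inner φ).pow 2)
    (Eventually.of_forall fun x => by
      rw [Real.norm_of_nonneg (sq_nonneg _)]; exact real_inner_sq_le _ _)

theorem memLp_inner (hk : IsCarlemanKernel k μ) (φ : H) : MemLp (fun x => ⟪k x, φ⟫) 2 μ :=
  (memLp_two_iff_integrable_sq (hk.aestronglyMeasurable_inner φ)).2 (hk.integrable_inner_sq φ)

theorem norm_toLp_sq (hk : IsCarlemanKernel k μ) (φ : H) :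
    ‖(hk.memLp_inner φ).toLp‖ ^ 2 = ∫ x, ⟪k x, φ⟫ ^ 2 ∂μ := by
  rw [norm_sq_eq_integral_sq]
  refine integral_congr_ae ?_
  filter_upwards [(hk.memLp_inner φ).coeFn_toLp] with x hx
  rw [hx]

/-- The operator `φ ↦ ⟪k ·, φ⟫`. -/
def operator (hk : IsCarlemanKernel k μ) : H →L[ℝ] Lp ℝ 2 μ :=
  LinearMap.mkContinuous
    { toFun := fun φ => (hk.memLp_inner φ).toLp
      map_add' := fun φ ψ => by
        rw [← MemLp.toLp_add]
        exact MemLp.toLp_congr _ _ (Eventually.of_forall fun x => inner_add_right _ _ _)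
      map_smul' := fun c φ => by
        rw [RingHom.id_apply, ← MemLp.toLp_const_smul]
        exact MemLp.toLp_congr _ _ (Eventually.of_forall fun x => inner_smul_right _ _ _) }
    (√(∫ x, ‖k x‖ ^ 2 ∂μ)) fun φ => by
      refine (abs_le_of_sq_le_sq' ?_ (by positivity)).2
      rw [mul_pow, Real.sq_sqrt (by positivity), ← integral_mul_const]
      exact (hk.norm_toLp_sq φ).trans_le <| integral_mono (hk.integrable_inner_sq φ)
        (hk.integrable_norm_sq.mul_const _) fun x => real_inner_sq_le _ _

theorem coeFn_operator (hk : IsCarlemanKernel k μ) (φ : H) :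
    hk.operator φ =ᵐ[μ] fun x => ⟪k x, φ⟫ :=
  (hk.memLp_inner φ).coeFn_toLp

/-- Bessel's inequality for the vectors `k x` shows that `∑ ‖T b‖²` over a Hilbert basis is at most
`∫ ‖k x‖²`. -/
theorem isCompactOperator [CompleteSpace H] (hk : IsCarlemanKernel k μ) :
    IsCompactOperator hk.operator := by
  obtain ⟨w, b, -⟩ := exists_hilbertBasis ℝ H
  refine isCompactOperator_of_summable_norm_sq _ b <|
    summable_of_sum_le (c := ∫ x, ‖k x‖ ^ 2 ∂μ) (fun i => by positivity) fun s => ?_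
  calc ∑ i ∈ s, ‖hk.operator (b i)‖ ^ 2 = ∑ i ∈ s, ∫ x, ⟪k x, b i⟫ ^ 2 ∂μ :=
        Finset.sum_congr rfl fun i _ => hk.norm_toLp_sq (b i)
    _ = ∫ x, ∑ i ∈ s, ⟪k x, b i⟫ ^ 2 ∂μ :=
        (integral_finsetSum _ fun i _ => hk.integrable_inner_sq (b i)).symm
    _ ≤ ∫ x, ‖k x‖ ^ 2 ∂μ := by
        refine integral_mono (integrable_finsetSum _ fun i _ => hk.integrable_inner_sq (b i))
          hk.integrable_norm_sq fun x => ?_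
        refine le_trans (Finset.sum_congr rfl fun i _ => ?_).le
          (b.orthonormal.sum_inner_products_le (s := s) (k x))
        rw [Real.norm_eq_abs, sq_abs, real_inner_comm]

end IsCarlemanKernel

end Carleman

variable {X Y : Type*} [MeasurableSpace Y] {ν : Measure Y} {k : X → Y → ℝ}

open Classical in
/-- The section `k x` of a kernel as an element of `L²`, with value `0` for the negligible set of
`x` for which `k x` is not square integrable. -/
def kernelSection (k : X → Y → ℝ) (ν : Measure Y) (x : X) : Lp ℝ 2 ν :=
  if hx : MemLp (k x) 2 ν then hx.toLp else 0

theorem coeFn_kernelSection {x : X} (hx : MemLp (k x) 2 ν) : kernelSection k ν x =ᵐ[ν] k x := by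
  rw [kernelSection, dif_pos hx]
  exact hx.coeFn_toLp

theorem inner_kernelSection {x : X} (hx : MemLp (k x) 2 ν) (φ : Lp ℝ 2 ν) :
    ⟪kernelSection k ν x, φ⟫ = ∫ y, k x y * φ y ∂ν := by
  rw [L2.inner_def]
  refine integral_congr_ae ?_
  filter_upwards [coeFn_kernelSection hx] with y hy
  rw [hy, RCLike.inner_apply', conj_trivial]

theorem norm_kernelSection_sq {x : X} (hx : MemLp (k x) 2 ν) :
    ‖kernelSection k ν x‖ ^ 2 = ∫ y, k x y ^ 2 ∂ν := by
  rw [norm_sq_eq_integral_sq]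
  refine integral_congr_ae ?_
  filter_upwards [coeFn_kernelSection hx] with y hy
  rw [hy]

variable [MeasurableSpace X] {μ : Measure X}

theorem memLp_two_mul_prod [SFinite μ] [SFinite ν] {f : X → ℝ} {g : Y → ℝ} (hf : MemLp f 2 μ)
    (hg : MemLp g 2 ν) : MemLp (fun z : X × Y => f z.1 * g z.2) 2 (μ.prod ν) := by
  refine (memLp_two_iff_integrable_sq (hf.1.comp_fst.mul hg.1.comp_snd)).2 ?_
  exact (hf.integrable_sq.mul_prod hg.integrable_sq).congr
    (Eventually.of_forall fun z => (mul_pow _ _ _).symm)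

variable [SFinite μ] [SFinite ν]

theorem ae_memLp_section (hk : MemLp (Function.uncurry k) 2 (μ.prod ν)) :
    ∀ᵐ x ∂μ, MemLp (k x) 2 ν := by
  filter_upwards [hk.1.prodMk_left, hk.integrable_sq.prod_right_ae] with x hmeas hint
  exact (memLp_two_iff_integrable_sq hmeas).2 hint

theorem isCarlemanKernel_kernelSection (hk : MemLp (Function.uncurry k) 2 (μ.prod ν)) :
    IsCarlemanKernel (kernelSection k ν) μ where
  aestronglyMeasurable_inner φ := by
    have hmeas : AEStronglyMeasurable (fun z : X × Y => k z.1 z.2 * φ z.2) (μ.prod ν) :=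
      hk.1.mul (Lp.aestronglyMeasurable φ).comp_snd
    refine hmeas.integral_prod_right'.congr ?_
    filter_upwards [ae_memLp_section hk] with x hx
    exact (inner_kernelSection hx φ).symm
  integrable_norm_sq := by
    refine hk.integrable_sq.integral_prod_left.congr ?_
    filter_upwards [ae_memLp_section hk] with x hx
    exact (norm_kernelSection_sq hx).symm

/-- The Hilbert–Schmidt operator with the square integrable kernel `k`. -/
def hsOperator (hk : MemLp (Function.uncurry k) 2 (μ.prod ν)) : Lp ℝ 2 ν →L[ℝ] Lp ℝ 2 μ :=
  (isCarlemanKernel_kernelSection hk).operator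

theorem coeFn_hsOperator (hk : MemLp (Function.uncurry k) 2 (μ.prod ν)) (φ : Lp ℝ 2 ν) :
    hsOperator hk φ =ᵐ[μ] fun x => ∫ y, k x y * φ y ∂ν := by
  filter_upwards [(isCarlemanKernel_kernelSection hk).coeFn_operator φ, ae_memLp_section hk]
    with x hx hkx
  rw [← inner_kernelSection hkx, ← hx, hsOperator]

theorem isCompactOperator_hsOperator (hk : MemLp (Function.uncurry k) 2 (μ.prod ν)) :
    IsCompactOperator (hsOperator hk) :=
  (isCarlemanKernel_kernelSection hk).isCompactOperator

theorem integrable_kernel_mul_prod (hk : MemLp (Function.uncurry k) 2 (μ.prod ν))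
    (φ : Lp ℝ 2 μ) (ψ : Lp ℝ 2 ν) :
    Integrable (fun z : X × Y => k z.1 z.2 * (φ z.1 * ψ z.2)) (μ.prod ν) :=
  hk.integrable_mul (memLp_two_mul_prod (Lp.memLp φ) (Lp.memLp ψ))

theorem inner_hsOperator (hk : MemLp (Function.uncurry k) 2 (μ.prod ν)) (φ : Lp ℝ 2 μ)
    (ψ : Lp ℝ 2 ν) :
    ⟪φ, hsOperator hk ψ⟫ = ∫ z, k z.1 z.2 * (φ z.1 * ψ z.2) ∂μ.prod ν := by
  rw [integral_prod _ (integrable_kernel_mul_prod hk φ ψ), L2.inner_def]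
  refine integral_congr_ae ?_
  filter_upwards [coeFn_hsOperator hk ψ] with x hx
  rw [hx, RCLike.inner_apply', conj_trivial, ← integral_const_mul]
  exact integral_congr_ae (Eventually.of_forall fun y => mul_left_comm _ _ _)

theorem inner_hsOperator_left {k : X → X → ℝ} (hk : MemLp (Function.uncurry k) 2 (μ.prod μ))
    {s : ℝ} (hs : ∀ x y, k y x = s * k x y) (φ ψ : Lp ℝ 2 μ) :
    ⟪hsOperator hk φ, ψ⟫ = s * ⟪φ, hsOperator hk ψ⟫ := by
  rw [real_inner_comm, inner_hsOperator, inner_hsOperator, ← integral_prod_swap,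
    ← integral_const_mul]
  refine integral_congr_ae (Eventually.of_forall fun z => ?_)
  simp only [Prod.fst_swap, Prod.snd_swap, hs z.1 z.2]
  ring

theorem hsOperator_compMeasurePreserving {k : X → X → ℝ}
    (hk : MemLp (Function.uncurry k) 2 (μ.prod μ)) {e : X ≃ᵐ X} (he : MeasurePreserving e μ μ)
    {s : ℝ} (hs : ∀ x y, k (e x) (e y) = s * k x y) (φ : Lp ℝ 2 μ) :
    Lp.compMeasurePreservingₗᵢ ℝ e he (hsOperator hk φ) =
      s • hsOperator hk (Lp.compMeasurePreservingₗᵢ ℝ e he φ) := by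
  refine Lp.ext ?_
  set ψ := Lp.compMeasurePreservingₗᵢ ℝ e he φ
  have hψ : ψ =ᵐ[μ] fun y => φ (e y) := Lp.coeFn_compMeasurePreserving φ he
  filter_upwards [Lp.coeFn_compMeasurePreserving (hsOperator hk φ) he,
    he.quasiMeasurePreserving.ae (coeFn_hsOperator hk φ), Lp.coeFn_smul s (hsOperator hk ψ),
    coeFn_hsOperator hk ψ] with x hleft hx hsmul hright
  calc Lp.compMeasurePreserving e he (hsOperator hk φ) x = ∫ y, k (e x) y * φ y ∂μ :=
        hleft.trans hx
    _ = ∫ y, k (e x) (e y) * φ (e y) ∂μ :=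
        (he.integral_comp e.measurableEmbedding fun y => k (e x) y * φ y).symm
    _ = ∫ y, s * (k x y * ψ y) ∂μ := by
        refine integral_congr_ae ?_
        filter_upwards [hψ] with y hy
        rw [hs, hy, mul_assoc]
    _ = (s • hsOperator hk ψ) x := by
        rw [integral_const_mul, hsmul, Pi.smul_apply, hright, smul_eq_mul]

end HilbertSchmidt

/-! ### The spectral gap of a Markov operator -/

/-- The density, with respect to the reversing measure `μ`, of a reversible Markov kernel that is
square integrable and charges almost every transition. -/
structure IsMarkovDensity {X : Type*} [MeasurableSpace X] (k : X → X → ℝ) (μ : Measure X) :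
    Prop where
  memLp : MemLp (Function.uncurry k) 2 (μ.prod μ)
  symm : ∀ x y, k y x = k x y
  nonneg : ∀ x y, 0 ≤ k x y
  pos : ∀ᵐ z ∂μ.prod μ, 0 < k z.1 z.2
  integral_eq_one : ∀ x, ∫ y, k x y ∂μ = 1

namespace IsMarkovDensity

variable {X : Type*} [MeasurableSpace X] {k : X → X → ℝ} {μ : Measure X}

theorem integrable (hk : IsMarkovDensity k μ) (x : X) : Integrable (k x) μ :=
  not_imp_comm.1 integral_undef (by simp [hk.integral_eq_one])

variable [IsFiniteMeasure μ]

theorem integrable_mul_sq_fst (hk : IsMarkovDensity k μ) (φ : Lp ℝ 2 μ) :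
    Integrable (fun z : X × X => k z.1 z.2 * φ z.1 ^ 2) (μ.prod μ) := by
  have hmeas : AEStronglyMeasurable (fun z : X × X => k z.1 z.2 * φ z.1 ^ 2) (μ.prod μ) :=
    hk.memLp.1.mul ((Lp.aestronglyMeasurable φ).comp_fst.pow 2)
  refine (integrable_prod_iff hmeas).2
    ⟨Eventually.of_forall fun x => (hk.integrable x).mul_const (φ x ^ 2), ?_⟩
  refine (Lp.memLp φ).integrable_sq.congr (Eventually.of_forall fun x => ?_)
  simp only [norm_mul, Real.norm_of_nonneg (hk.nonneg _ _), norm_pow, Real.norm_eq_abs, sq_abs]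
  rw [integral_mul_const, hk.integral_eq_one, one_mul]

theorem integral_mul_sq_fst (hk : IsMarkovDensity k μ) (φ : Lp ℝ 2 μ) :
    ∫ z : X × X, k z.1 z.2 * φ z.1 ^ 2 ∂μ.prod μ = ‖φ‖ ^ 2 := by
  rw [integral_prod _ (hk.integrable_mul_sq_fst φ), norm_sq_eq_integral_sq]
  refine integral_congr_ae (Eventually.of_forall fun x => ?_)
  simp only [integral_mul_const, hk.integral_eq_one, one_mul]

theorem integrable_mul_sq_snd (hk : IsMarkovDensity k μ) (φ : Lp ℝ 2 μ) :
    Integrable (fun z : X × X => k z.1 z.2 * φ z.2 ^ 2) (μ.prod μ) :=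
  (hk.integrable_mul_sq_fst φ).swap.congr (Eventually.of_forall fun z => by
    simp only [Function.comp_apply, Prod.fst_swap, Prod.snd_swap, hk.symm z.1 z.2])

theorem integral_mul_sq_snd (hk : IsMarkovDensity k μ) (φ : Lp ℝ 2 μ) :
    ∫ z : X × X, k z.1 z.2 * φ z.2 ^ 2 ∂μ.prod μ = ‖φ‖ ^ 2 := by
  rw [← hk.integral_mul_sq_fst φ, ← integral_prod_swap]
  simp only [Prod.fst_swap, Prod.snd_swap, hk.symm]

theorem integrable_mul_sub_sq (hk : IsMarkovDensity k μ) (φ ψ : Lp ℝ 2 μ) :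
    Integrable (fun z : X × X => k z.1 z.2 * (φ z.1 - ψ z.2) ^ 2) (μ.prod μ) :=
  (((hk.integrable_mul_sq_fst φ).add (hk.integrable_mul_sq_snd ψ)).sub
    ((integrable_kernel_mul_prod hk.memLp φ ψ).const_mul 2)).congr
    (Eventually.of_forall fun z => by simp only [Pi.add_apply, Pi.sub_apply]; ring)

theorem integral_mul_sub_sq (hk : IsMarkovDensity k μ) (φ ψ : Lp ℝ 2 μ) :
    ∫ z : X × X, k z.1 z.2 * (φ z.1 - ψ z.2) ^ 2 ∂μ.prod μ =
      ‖φ‖ ^ 2 + ‖ψ‖ ^ 2 - 2 * ⟪φ, hsOperator hk.memLp ψ⟫ := by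
  have hφ := hk.integrable_mul_sq_fst φ
  have hψ := hk.integrable_mul_sq_snd ψ
  rw [inner_hsOperator, ← integral_const_mul, ← hk.integral_mul_sq_fst φ,
    ← hk.integral_mul_sq_snd ψ, ← integral_add hφ hψ,
    ← integral_sub (by exact hφ.add hψ)
      ((integrable_kernel_mul_prod hk.memLp φ ψ).const_mul 2)]
  exact integral_congr_ae (Eventually.of_forall fun z => by simp only; ring)

theorem ae_eq_of_integral_mul_sub_sq_eq_zero (hk : IsMarkovDensity k μ) {φ ψ : Lp ℝ 2 μ}
    (hzero : ∫ z : X × X, k z.1 z.2 * (φ z.1 - ψ z.2) ^ 2 ∂μ.prod μ = 0) :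
    ∀ᵐ z ∂μ.prod μ, φ z.1 = ψ z.2 := by
  have hnonneg (z : X × X) : 0 ≤ k z.1 z.2 * (φ z.1 - ψ z.2) ^ 2 :=
    mul_nonneg (hk.nonneg _ _) (sq_nonneg _)
  filter_upwards [hk.pos,
    (integral_eq_zero_iff_of_nonneg hnonneg (hk.integrable_mul_sub_sq φ ψ)).1 hzero] with z hpos hz
  exact sub_eq_zero.1 (pow_eq_zero_iff two_ne_zero |>.1 ((mul_eq_zero.1 hz).resolve_left hpos.ne'))

theorem exists_eq_const_of_ae_eq_prod {φ : X → ℝ} {ψ : Lp ℝ 2 μ}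
    (h : ∀ᵐ z ∂μ.prod μ, φ z.1 = ψ z.2) : ∃ c : ℝ, ψ = c • Lp.const 2 μ (1 : ℝ) := by
  have hconst : ∃ c : ℝ, ∀ᵐ y ∂μ, c = ψ y := by
    rcases eq_or_neBot (ae μ) with hμ | hμ
    · simp [hμ]
    · obtain ⟨x, hx⟩ := (Measure.ae_ae_of_ae_prod h).exists
      exact ⟨φ x, hx⟩
  obtain ⟨c, hc⟩ := hconst
  refine ⟨c, Lp.ext ?_⟩
  filter_upwards [hc, Lp.coeFn_smul c (Lp.const 2 μ (1 : ℝ)), Lp.coeFn_const (p := 2) (μ := μ)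
    (1 : ℝ)] with x hx hsmul hone
  rw [hsmul, Pi.smul_apply, hone, Function.const_apply, smul_eq_mul, mul_one, hx]

theorem norm_hsOperator_lt (hk : IsMarkovDensity k μ) {ψ : Lp ℝ 2 μ} (hψ : ψ ≠ 0)
    (horth : ⟪Lp.const 2 μ (1 : ℝ), ψ⟫ = 0) : ‖hsOperator hk.memLp ψ‖ < ‖ψ‖ := by
  have hdirichlet := hk.integral_mul_sub_sq (hsOperator hk.memLp ψ) ψ
  rw [real_inner_self_eq_norm_sq] at hdirichlet
  have hnonneg : 0 ≤ ∫ z : X × X, k z.1 z.2 * (hsOperator hk.memLp ψ z.1 - ψ z.2) ^ 2 ∂μ.prod μ :=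
    integral_nonneg fun z => mul_nonneg (hk.nonneg _ _) (sq_nonneg _)
  refine lt_of_pow_lt_pow_left₀ 2 (norm_nonneg _) (lt_of_le_of_ne (by linarith) fun heq => hψ ?_)
  obtain ⟨c, hc⟩ := exists_eq_const_of_ae_eq_prod
    (hk.ae_eq_of_integral_mul_sub_sq_eq_zero (by rw [hdirichlet, heq]; ring))
  rw [← inner_self_eq_zero (𝕜 := ℝ)]
  nth_rewrite 1 [hc]
  rw [real_inner_smul_left, horth, mul_zero]

theorem hsOperator_const (hk : IsMarkovDensity k μ) :
    hsOperator hk.memLp (Lp.const 2 μ 1) = Lp.const 2 μ 1 := by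
  refine Lp.ext ?_
  have hone := Lp.coeFn_const (p := 2) (μ := μ) (1 : ℝ)
  filter_upwards [coeFn_hsOperator hk.memLp (Lp.const 2 μ 1), hone] with x hx hone'
  rw [hx, hone', Function.const_apply]
  refine Eq.trans ?_ (hk.integral_eq_one x)
  refine integral_congr_ae ?_
  filter_upwards [hone] with y hy
  rw [hy, Function.const_apply, mul_one]

/-- A Hilbert–Schmidt Markov operator as a gapped operator that fixes the constants. -/
def gappedOperator (hk : IsMarkovDensity k μ) : GappedOperator (Lp ℝ 2 μ) where
  K := hsOperator hk.memLp
  v := Lp.const 2 μ 1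
  K_symm φ ψ := by
    simpa using inner_hsOperator_left hk.memLp (s := 1) (fun x y => by simp [hk.symm x y]) φ ψ
  K_v := hk.hsOperator_const
  gap := by
    refine opNorm_lt_one_of_isCompactOperator
      ((isCompactOperator_hsOperator hk.memLp).comp_clm _) fun ψ hψ => ?_
    exact hk.norm_hsOperator_lt (by simpa using hψ)
      (Submodule.mem_orthogonal_singleton_iff_inner_right.1 ψ.2)

end IsMarkovDensity

/-! ### The phonon kernel in dimensionless variables -/

section PhononKernel

theorem fermi_eq (x : ℝ) : fermi x = Real.exp (-(x / 2)) / (2 * Real.cosh (x / 2)) := by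
  have hexp : Real.exp x = Real.exp (x / 2) ^ 2 := by rw [← Real.exp_nat_mul]; ring_nf
  rw [fermi, Real.cosh_eq, hexp, Real.exp_neg]
  field_simp

theorem one_sub_fermi (x : ℝ) : 1 - fermi x = fermi (-x) := by
  rw [fermi, fermi, Real.exp_neg]
  field_simp
  ring

theorem bose_eq (x : ℝ) : bose x = Real.exp (-(x / 2)) / (2 * Real.sinh (x / 2)) := by
  have hexp : Real.exp x = Real.exp (x / 2) ^ 2 := by rw [← Real.exp_nat_mul]; ring_nf
  have hsinh : 2 * Real.sinh (x / 2) = Real.exp (-(x / 2)) * (Real.exp x - 1) := by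
    rw [Real.sinh_eq, hexp, Real.exp_neg]
    field_simp
  rw [bose, hsinh, div_mul_cancel_left₀ (Real.exp_pos _).ne', one_div]

theorem weight_eq (T ε : ℝ) : weight T ε = 1 / (4 * Real.cosh (ε / T / 2) ^ 2) := by
  rw [weight, one_sub_fermi, fermi_eq, fermi_eq, neg_div, Real.cosh_neg, div_mul_div_comm,
    ← Real.exp_add, neg_neg, neg_add_cancel, Real.exp_zero]
  ring

theorem bose_add_fermi {y : ℝ} (hy : y ≠ 0) (x : ℝ) :
    bose y + fermi (y + x) =
      Real.cosh (x / 2) / Real.cosh ((x + y) / 2) / (2 * Real.sinh (y / 2)) := by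
  have hsinh : Real.sinh (y / 2) ≠ 0 := by simpa [Real.sinh_eq_zero] using hy
  have hcosh := (Real.cosh_pos ((x + y) / 2)).ne'
  have haddition : Real.exp (-(y / 2)) * Real.cosh ((x + y) / 2) +
      Real.exp (-((x + y) / 2)) * Real.sinh (y / 2) = Real.cosh (x / 2) := by
    rw [add_div, neg_add, Real.exp_add, Real.cosh_eq, Real.cosh_eq, Real.sinh_eq, neg_add,
      Real.exp_add, Real.exp_add, Real.exp_neg, Real.exp_neg]
    field_simp
    ring
  rw [bose_eq, fermi_eq, add_comm y x, ← haddition]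
  field_simp

/-- The phonon spectral factor `y² / |sinh (y / 2)|`, through which `kbar x y` depends on the
transferred energy `y`, apart from the Fermi factors. -/
def phononSpectrum (y : ℝ) : ℝ := y ^ 2 / |Real.sinh (y / 2)|

theorem kbar_eq (x y : ℝ) :
    kbar x y = Real.cosh (x / 2) / Real.cosh ((x + y) / 2) * (phononSpectrum y / 2) := by
  rcases lt_trichotomy y 0 with hy | rfl | hy
  · have hsinh : Real.sinh (y / 2) < 0 := Real.sinh_neg_iff.2 (by linarith)
    have hsinh_ne := hsinh.ne
    rw [kbar, bose_add_fermi hy.ne, phononSpectrum, Real.sign_of_neg hy, abs_of_neg hsinh]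
    field_simp
  · simp [kbar, phononSpectrum]
  · have hsinh : 0 < Real.sinh (y / 2) := Real.sinh_pos_iff.2 (by linarith)
    rw [kbar, bose_add_fermi hy.ne', phononSpectrum, Real.sign_of_pos hy, abs_of_pos hsinh]
    field_simp

theorem phononSpectrum_nonneg (y : ℝ) : 0 ≤ phononSpectrum y := by
  unfold phononSpectrum
  positivity

theorem phononSpectrum_pos {y : ℝ} (hy : y ≠ 0) : 0 < phononSpectrum y := by
  have : Real.sinh (y / 2) ≠ 0 := by simpa [Real.sinh_eq_zero] using hy
  unfold phononSpectrum
  positivity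

theorem phononSpectrum_neg (y : ℝ) : phononSpectrum (-y) = phononSpectrum y := by
  simp [phononSpectrum, neg_div, Real.sinh_neg]

@[fun_prop]
theorem measurable_phononSpectrum : Measurable phononSpectrum := by
  unfold phononSpectrum
  fun_prop

theorem abs_mul_exp_le_abs_sinh (y : ℝ) : |y| / 4 * Real.exp (|y| / 4) ≤ |Real.sinh (y / 2)| := by
  have hdouble : |Real.sinh (y / 2)| = 2 * Real.sinh (|y| / 4) * Real.cosh (|y| / 4) := by
    rw [Real.abs_sinh, abs_div, ← Real.sinh_two_mul]
    norm_num
    ring_nf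
  have hsinh : |y| / 4 ≤ Real.sinh (|y| / 4) := Real.self_le_sinh_iff.2 (by positivity)
  have hcosh : Real.exp (|y| / 4) ≤ 2 * Real.cosh (|y| / 4) := by
    rw [Real.cosh_eq]
    linarith [Real.exp_pos (-(|y| / 4))]
  rw [hdouble]
  calc |y| / 4 * Real.exp (|y| / 4) ≤ Real.sinh (|y| / 4) * (2 * Real.cosh (|y| / 4)) := by gcongr
    _ = _ := by ring

theorem phononSpectrum_mul_exp_le (y : ℝ) : phononSpectrum y * Real.exp (|y| / 4) ≤ 4 * |y| := by
  rcases eq_or_ne y 0 with rfl | hy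
  · simp [phononSpectrum]
  have hpos : 0 < |y| / 4 * Real.exp (|y| / 4) := by positivity
  rw [phononSpectrum, div_mul_eq_mul_div, div_le_iff₀ (hpos.trans_le (abs_mul_exp_le_abs_sinh y)),
    ← sq_abs]
  calc |y| ^ 2 * Real.exp (|y| / 4) = 4 * |y| * (|y| / 4 * Real.exp (|y| / 4)) := by ring
    _ ≤ _ := by gcongr; exact abs_mul_exp_le_abs_sinh y

theorem abs_pow_le_factorial_mul_exp {c : ℝ} (hc : 0 < c) (n : ℕ) (y : ℝ) :
    |y| ^ n ≤ c ^ n * n.factorial * Real.exp (|y| / c) := by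
  have hexp := Real.pow_div_factorial_le_exp (|y| / c) (by positivity) n
  rwa [div_pow, div_div, div_le_iff₀ (by positivity), mul_comm] at hexp

theorem exists_abs_pow_mul_phononSpectrum_le (n : ℕ) :
    ∃ C : ℝ, ∀ y, |y ^ n * phononSpectrum y| ≤ C * (1 + y ^ 2)⁻¹ := by
  let c (m : ℕ) : ℝ := 4 ^ m * m.factorial
  refine ⟨4 * (c (n + 1) + c (n + 3)), fun y => ?_⟩
  rw [abs_mul, abs_pow, abs_of_nonneg (phononSpectrum_nonneg y), ← div_eq_mul_inv,
    le_div_iff₀ (by positivity)]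
  refine le_of_mul_le_mul_right ?_ (Real.exp_pos (|y| / 4))
  have hlow : |y| ^ (n + 1) ≤ c (n + 1) * Real.exp (|y| / 4) :=
    abs_pow_le_factorial_mul_exp (by norm_num) _ y
  have hhigh : |y| ^ (n + 3) ≤ c (n + 3) * Real.exp (|y| / 4) :=
    abs_pow_le_factorial_mul_exp (by norm_num) _ y
  calc |y| ^ n * phononSpectrum y * (1 + y ^ 2) * Real.exp (|y| / 4)
      = |y| ^ n * (1 + |y| ^ 2) * (phononSpectrum y * Real.exp (|y| / 4)) := by rw [sq_abs]; ring
    _ ≤ |y| ^ n * (1 + |y| ^ 2) * (4 * |y|) :=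
        mul_le_mul_of_nonneg_left (phononSpectrum_mul_exp_le y) (by positivity)
    _ = 4 * (|y| ^ (n + 1) + |y| ^ (n + 3)) := by ring
    _ ≤ 4 * (c (n + 1) + c (n + 3)) * Real.exp (|y| / 4) := by linarith

theorem integrable_pow_mul_phononSpectrum (n : ℕ) :
    Integrable fun y => y ^ n * phononSpectrum y := by
  obtain ⟨C, hC⟩ := exists_abs_pow_mul_phononSpectrum_le n
  exact (integrable_inv_one_add_sq.const_mul C).mono' (by fun_prop) (Eventually.of_forall hC)

theorem integrable_phononSpectrum : Integrable phononSpectrum := by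
  simpa using integrable_pow_mul_phononSpectrum 0

theorem integrable_pow_mul_phononSpectrum_sq (n : ℕ) :
    Integrable fun y => (y ^ n * phononSpectrum y) ^ 2 := by
  obtain ⟨C, hC⟩ := exists_abs_pow_mul_phononSpectrum_le n
  have hbound (y : ℝ) : |y ^ n * phononSpectrum y| ≤ |C| :=
    (hC y).trans <| (mul_le_mul_of_nonneg_right (le_abs_self C) (by positivity)).trans <|
      mul_le_of_le_one_right (abs_nonneg _) (inv_le_one_of_one_le₀ (by nlinarith))
  simp only [sq]
  exact (integrable_pow_mul_phononSpectrum n).bdd_mul (by fun_prop) (Eventually.of_forall hbound)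

theorem kbar_pos {y : ℝ} (hy : y ≠ 0) (x : ℝ) : 0 < kbar x y := by
  have hJ := phononSpectrum_pos hy
  have := Real.cosh_pos (x / 2)
  have := Real.cosh_pos ((x + y) / 2)
  rw [kbar_eq]
  positivity

theorem kbar_zero (x : ℝ) : kbar x 0 = 0 := by simp [kbar]

theorem kbar_nonneg (x y : ℝ) : 0 ≤ kbar x y := by
  rcases eq_or_ne y 0 with rfl | hy
  · exact (kbar_zero x).ge
  · exact (kbar_pos hy x).le

theorem kbar_neg_neg (x y : ℝ) : kbar (-x) (-y) = kbar x y := by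
  rw [kbar_eq, kbar_eq, phononSpectrum_neg, neg_div, Real.cosh_neg, ← neg_add, neg_div,
    Real.cosh_neg]

theorem kbar_le (x y : ℝ) : kbar x y ≤ Real.cosh (x / 2) * (phononSpectrum y / 2) := by
  have hJ := phononSpectrum_nonneg y
  rw [kbar_eq]
  gcongr
  exact div_le_self (Real.cosh_pos _).le (Real.one_le_cosh _)

theorem kbar_lt_kbar_neg {x y : ℝ} (hx : 0 < x) (hy : 0 < y) : kbar x y < kbar x (-y) := by
  have hJ := phononSpectrum_pos hy.ne'
  have := Real.cosh_pos (x / 2)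
  rw [kbar_eq, kbar_eq, phononSpectrum_neg]
  gcongr
  rw [Real.cosh_lt_cosh, abs_lt, abs_of_pos (by linarith)]
  constructor <;> linarith

@[fun_prop]
theorem measurable_kbar : Measurable fun p : ℝ × ℝ => kbar p.1 p.2 := by
  simp only [kbar_eq]
  fun_prop

theorem integrable_pow_mul_kbar (n : ℕ) (x : ℝ) : Integrable fun y => y ^ n * kbar x y := by
  have hmeas : Measurable fun y => y ^ n * kbar x y :=
    (measurable_id.pow_const n).mul (measurable_kbar.comp measurable_prodMk_left)
  refine ((integrable_pow_mul_phononSpectrum n).norm.const_mul (Real.cosh (x / 2) / 2)).mono'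
    hmeas.aestronglyMeasurable (Eventually.of_forall fun y => ?_)
  rw [norm_mul, norm_mul, Real.norm_of_nonneg (kbar_nonneg x y),
    Real.norm_of_nonneg (phononSpectrum_nonneg y)]
  calc ‖y ^ n‖ * kbar x y ≤ ‖y ^ n‖ * (Real.cosh (x / 2) * (phononSpectrum y / 2)) := by
        gcongr
        exact kbar_le x y
    _ = _ := by ring

theorem integrable_kbar (x : ℝ) : Integrable (kbar x) := by
  simpa using integrable_pow_mul_kbar 0 x

theorem integral_pos_of_ae_pos {X : Type*} [MeasurableSpace X] {μ : Measure X} [NeZero μ]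
    {f : X → ℝ} (hf : Integrable f μ) (hpos : ∀ᵐ x ∂μ, 0 < f x) : 0 < ∫ x, f x ∂μ := by
  have hnonneg : 0 ≤ᵐ[μ] f := hpos.mono fun x hx => hx.le
  refine (integral_nonneg_of_ae hnonneg).lt_of_ne fun hzero => ?_
  have hfalse : ∀ᵐ _ ∂μ, False := by
    filter_upwards [hpos, (integral_eq_zero_iff_of_nonneg_ae hnonneg hf).1 hzero.symm] with x hx h0
    exact hx.ne' h0
  exact hfalse.exists.choose_spec

theorem integral_mul_kbar_neg {x : ℝ} (hx : 0 < x) : ∫ y, y * kbar x y < 0 := by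
  have hint : Integrable fun y => y * kbar x y := by simpa using integrable_pow_mul_kbar 1 x
  have hpos : 0 < ∫ y, -(y * kbar x y + -y * kbar x (-y)) := by
    refine integral_pos_of_ae_pos (hint.add hint.comp_neg).neg ?_
    filter_upwards [Measure.ae_ne volume (0 : ℝ)] with y hy
    rcases lt_or_gt_of_ne hy with hneg | hpos
    · have hlt := kbar_lt_kbar_neg hx (neg_pos.2 hneg)
      rw [neg_neg] at hlt
      nlinarith
    · nlinarith [kbar_lt_kbar_neg hx hpos]
  rw [integral_neg, integral_add hint hint.comp_neg,
    integral_neg_eq_self (fun y => y * kbar x y)] at hpos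
  linarith

/-- The single-particle rate `Γ₀` in dimensionless variables. -/
def rate (x : ℝ) : ℝ := ∫ y, kbar x y

@[fun_prop]
theorem measurable_rate : Measurable rate :=
  (measurable_kbar.stronglyMeasurable.integral_prod_right (ν := volume)).measurable

theorem rate_neg (x : ℝ) : rate (-x) = rate x := by
  rw [rate, ← integral_neg_eq_self]
  simp only [kbar_neg_neg, rate]

theorem rate_pos (x : ℝ) : 0 < rate x :=
  integral_pos_of_ae_pos (integrable_kbar x)
    ((Measure.ae_ne volume 0).mono fun _ hy => kbar_pos hy x)

theorem rate_le (x : ℝ) : rate x ≤ Real.cosh (x / 2) * ∫ y, phononSpectrum y / 2 := by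
  rw [← integral_const_mul]
  exact integral_mono (integrable_kbar x)
    ((integrable_phononSpectrum.div_const 2).const_mul _) (kbar_le x)

/-- Electrons of energy `x` can emit phonons of any energy up to `x`, so the rate grows like the
integral of the phonon density of states `s²`. -/
theorem sq_div_le_kbar_neg {x s : ℝ} (hs : 0 < s) (hsx : s ≤ x + 1) :
    s ^ 2 / (2 * Real.exp 1) ≤ kbar x (-s) := by
  have hcosh : Real.cosh ((x - s) / 2) ≤ Real.exp ((x - s) / 2 + 1) := by
    rw [Real.cosh_eq]
    have h₁ : Real.exp ((x - s) / 2) ≤ Real.exp ((x - s) / 2 + 1) := Real.exp_le_exp.2 (by linarith)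
    have h₂ : Real.exp (-((x - s) / 2)) ≤ Real.exp ((x - s) / 2 + 1) :=
      Real.exp_le_exp.2 (by linarith)
    linarith
  have hsinh : 2 * Real.sinh (s / 2) ≤ Real.exp (s / 2) := by
    rw [Real.sinh_eq]
    linarith [Real.exp_pos (-(s / 2))]
  have hnum : Real.exp (x / 2) ≤ 2 * Real.cosh (x / 2) := by
    rw [Real.cosh_eq]
    linarith [Real.exp_pos (-(x / 2))]
  have hsinh_pos : 0 < Real.sinh (s / 2) := Real.sinh_pos_iff.2 (by linarith)
  have := Real.cosh_pos ((x - s) / 2)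
  rw [kbar_eq, phononSpectrum_neg, phononSpectrum, abs_of_pos hsinh_pos, ← sub_eq_add_neg, div_div,
    div_mul_div_comm, div_le_div_iff₀ (by positivity) (by positivity)]
  calc s ^ 2 * (Real.cosh ((x - s) / 2) * (Real.sinh (s / 2) * 2))
      ≤ s ^ 2 * (Real.exp ((x - s) / 2 + 1) * Real.exp (s / 2)) := by
        gcongr
        linarith
    _ = s ^ 2 * Real.exp 1 * Real.exp (x / 2) := by
        rw [mul_assoc, ← Real.exp_add, ← Real.exp_add]
        ring_nf
    _ ≤ s ^ 2 * Real.exp 1 * (2 * Real.cosh (x / 2)) := by gcongr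
    _ = Real.cosh (x / 2) * s ^ 2 * (2 * Real.exp 1) := by ring

theorem cube_div_le_rate (x : ℝ) : (|x| + 1) ^ 3 / (6 * Real.exp 1) ≤ rate x := by
  wlog hx : 0 ≤ x generalizing x
  · simpa [rate_neg] using this (-x) (by linarith)
  rw [abs_of_nonneg hx]
  have hneg : Integrable fun s => kbar x (-s) := (integrable_kbar x).comp_neg
  calc (x + 1) ^ 3 / (6 * Real.exp 1) = ∫ s in Set.Ioc 0 (x + 1), s ^ 2 / (2 * Real.exp 1) := by
        rw [← intervalIntegral.integral_of_le (by linarith), intervalIntegral.integral_div,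
          integral_pow]
        norm_num
        ring
    _ ≤ ∫ s in Set.Ioc 0 (x + 1), kbar x (-s) :=
        setIntegral_mono_on (by fun_prop : Continuous _).integrableOn_Ioc hneg.integrableOn
          measurableSet_Ioc fun s hs => sq_div_le_kbar_neg hs.1 hs.2
    _ ≤ ∫ s, kbar x (-s) :=
        setIntegral_le_integral hneg (Eventually.of_forall fun s => kbar_nonneg x _)
    _ = rate x := integral_neg_eq_self (kbar x) volume

theorem inv_rate_le (x : ℝ) : (rate x)⁻¹ ≤ 6 * Real.exp 1 * (1 + x ^ 2)⁻¹ := by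
  rw [← div_eq_mul_inv, inv_le_comm₀ (rate_pos x) (by positivity), inv_div]
  refine le_trans ?_ (cube_div_le_rate x)
  gcongr
  rw [← sq_abs]
  nlinarith [abs_nonneg x, pow_nonneg (abs_nonneg x) 3]

theorem inv_rate_le_const (x : ℝ) : (rate x)⁻¹ ≤ 6 * Real.exp 1 :=
  (inv_rate_le x).trans <|
    mul_le_of_le_one_right (by positivity) (inv_le_one_of_one_le₀ (by nlinarith))

theorem integrable_inv_rate : Integrable fun x => (rate x)⁻¹ :=
  (integrable_inv_one_add_sq.const_mul (6 * Real.exp 1)).mono' (by fun_prop)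
    (Eventually.of_forall fun x => by
      rw [Real.norm_of_nonneg (inv_nonneg.2 (rate_pos x).le)]
      exact inv_rate_le x)

end PhononKernel

/-! ### Scattering in equilibrium -/

section Scattering

theorem map_withDensity_comp {X Y : Type*} [MeasurableSpace X] [MeasurableSpace Y]
    {μ : Measure X} {f : X → Y} {g : Y → ℝ≥0∞} (hf : Measurable f) (hg : Measurable g) :
    (μ.withDensity (g ∘ f)).map f = (μ.map f).withDensity g := by
  ext s hs
  rw [Measure.map_apply hf hs, withDensity_apply _ (hf hs), withDensity_apply _ hs,
    setLIntegral_map hs hg hf]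
  rfl

/-- The density `w Γ₀` of `σ` in the variable `ε / T`, up to the factor `T³ / ω₀²`. -/
def equilibriumDensity (x : ℝ) : ℝ := rate x / (4 * Real.cosh (x / 2) ^ 2)

theorem equilibriumDensity_pos (x : ℝ) : 0 < equilibriumDensity x :=
  div_pos (rate_pos x) (by positivity)

theorem equilibriumDensity_neg (x : ℝ) : equilibriumDensity (-x) = equilibriumDensity x := by
  rw [equilibriumDensity, equilibriumDensity, rate_neg, neg_div, Real.cosh_neg]

@[fun_prop]
theorem measurable_equilibriumDensity : Measurable equilibriumDensity := by
  unfold equilibriumDensity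
  fun_prop

theorem one_add_sq_le_cosh (x : ℝ) : 1 + x ^ 2 ≤ 17 * Real.cosh (x / 2) := by
  have hsq := abs_pow_le_factorial_mul_exp (by norm_num : (0 : ℝ) < 2) 2 x
  have hexp : Real.exp (|x| / 2) ≤ 2 * Real.cosh (x / 2) := by
    rw [← Real.cosh_abs, abs_div, abs_two, Real.cosh_eq]
    linarith [Real.exp_pos (-(|x| / 2))]
  rw [sq_abs] at hsq
  norm_num [Nat.factorial] at hsq
  linarith [Real.one_le_cosh (x / 2)]

theorem integrable_equilibriumDensity : Integrable equilibriumDensity := by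
  set c := ∫ y, phononSpectrum y / 2
  have hc : 0 ≤ c := integral_nonneg fun y => div_nonneg (phononSpectrum_nonneg y) two_pos.le
  refine (integrable_inv_one_add_sq.const_mul (17 * c / 4)).mono'
    measurable_equilibriumDensity.aestronglyMeasurable (Eventually.of_forall fun x => ?_)
  rw [Real.norm_of_nonneg (equilibriumDensity_pos x).le]
  calc equilibriumDensity x
      ≤ Real.cosh (x / 2) * c / (4 * Real.cosh (x / 2) ^ 2) := by
        unfold equilibriumDensity
        gcongr
        exact rate_le x
    _ = c / 4 * (Real.cosh (x / 2))⁻¹ := by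
        have := Real.cosh_pos (x / 2)
        field_simp
    _ ≤ c / 4 * (17 * (1 + x ^ 2)⁻¹) := by
        gcongr
        rw [← div_eq_mul_inv, inv_le_comm₀ (Real.cosh_pos _) (by positivity), inv_div,
          div_le_iff₀ (by norm_num), mul_comm]
        exact one_add_sq_le_cosh x
    _ = 17 * c / 4 * (1 + x ^ 2)⁻¹ := by ring

/-- The measure `σ` in the variable `ε / T`, up to the factor `T⁴ / ω₀²`. It reverses the
scattering process. -/
def equilibrium : Measure ℝ := volume.withDensity fun x => ENNReal.ofReal (equilibriumDensity x)

theorem ae_equilibrium : ae equilibrium = ae volume := by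
  refine Filter.ext fun s => (ae_withDensity_iff (by fun_prop)).trans ?_
  simp only [ne_eq, ENNReal.ofReal_eq_zero, not_le, equilibriumDensity_pos, forall_const]
  rfl

instance : IsFiniteMeasure equilibrium :=
  isFiniteMeasure_withDensity_ofReal integrable_equilibriumDensity.2

instance : NeZero equilibrium :=
  ⟨fun h => NeZero.ne (volume : Measure ℝ) <| ae_eq_bot.1 <| by rw [← ae_equilibrium, h, ae_zero]⟩

theorem integrable_equilibrium_iff {f : ℝ → ℝ} :
    Integrable f equilibrium ↔ Integrable fun x => f x * equilibriumDensity x := by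
  rw [equilibrium, integrable_withDensity_iff_integrable_smul' (by fun_prop) (by simp)]
  simp only [ENNReal.toReal_ofReal (equilibriumDensity_pos _).le, smul_eq_mul, mul_comm]

theorem integral_equilibrium (f : ℝ → ℝ) :
    ∫ x, f x ∂equilibrium = ∫ x, f x * equilibriumDensity x := by
  rw [equilibrium, integral_withDensity_eq_integral_toReal_smul (by fun_prop) (by simp)]
  simp only [ENNReal.toReal_ofReal (equilibriumDensity_pos _).le, smul_eq_mul, mul_comm]

theorem integrable_equilibrium_prod_iff {f : ℝ × ℝ → ℝ} :
    Integrable f (equilibrium.prod equilibrium) ↔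
      Integrable fun z => f z * (equilibriumDensity z.1 * equilibriumDensity z.2) := by
  rw [equilibrium, prod_withDensity (by fun_prop) (by fun_prop),
    integrable_withDensity_iff_integrable_smul' (by fun_prop)
      (Eventually.of_forall fun z => ENNReal.mul_lt_top ENNReal.ofReal_lt_top
        ENNReal.ofReal_lt_top), ← Measure.volume_eq_prod]
  simp only [ENNReal.toReal_mul, ENNReal.toReal_ofReal (equilibriumDensity_pos _).le, smul_eq_mul,
    mul_comm]

theorem measurePreserving_neg_equilibrium :
    MeasurePreserving (fun x : ℝ => -x) equilibrium equilibrium := by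
  refine ⟨measurable_neg, ?_⟩
  have hcomp : (fun x => ENNReal.ofReal (equilibriumDensity x)) ∘ (fun x : ℝ => -x) =
      fun x => ENNReal.ofReal (equilibriumDensity x) := by
    simp only [Function.comp_def, equilibriumDensity_neg]
  have hmap := map_withDensity_comp (μ := (volume : Measure ℝ)) measurable_neg
    (g := fun x => ENNReal.ofReal (equilibriumDensity x)) (by fun_prop)
  rwa [hcomp, (Measure.measurePreserving_neg (volume : Measure ℝ)).map_eq] at hmap

/-- The density with respect to `equilibrium` of the scattering kernel from `x` to `z`, weighted
with the `n`-th power of the energy transfer `z - x`. -/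
def momentDensity (n : ℕ) (x z : ℝ) : ℝ :=
  2 * Real.cosh (x / 2) * Real.cosh (z / 2) * ((z - x) ^ n * phononSpectrum (z - x)) /
    (rate x * rate z)

theorem momentDensity_swap (n : ℕ) (x z : ℝ) :
    momentDensity n z x = (-1) ^ n * momentDensity n x z := by
  unfold momentDensity
  rw [← neg_sub z x, phononSpectrum_neg, neg_pow (z - x)]
  ring

theorem momentDensity_neg_neg (n : ℕ) (x z : ℝ) :
    momentDensity n (-x) (-z) = (-1) ^ n * momentDensity n x z := by
  unfold momentDensity
  rw [neg_sub_neg, ← neg_sub z x, phononSpectrum_neg, neg_pow (z - x), rate_neg, rate_neg,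
    neg_div, neg_div, Real.cosh_neg, Real.cosh_neg]
  ring

theorem momentDensity_mul_equilibriumDensity (n : ℕ) (x z : ℝ) :
    momentDensity n x z * equilibriumDensity z = (z - x) ^ n * kbar x (z - x) / rate x := by
  rw [momentDensity, equilibriumDensity, kbar_eq, add_sub_cancel]
  have hz := rate_pos z
  have hx := rate_pos x
  have := Real.cosh_pos (z / 2)
  field_simp
  ring

@[fun_prop]
theorem measurable_momentDensity (n : ℕ) :
    Measurable fun z : ℝ × ℝ => momentDensity n z.1 z.2 := by
  unfold momentDensity
  fun_prop

theorem momentDensity_sq_mul_equilibriumDensity (n : ℕ) (x z : ℝ) :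
    momentDensity n x z ^ 2 * (equilibriumDensity x * equilibriumDensity z) =
      ((z - x) ^ n * phononSpectrum (z - x)) ^ 2 * (rate x)⁻¹ * (rate z)⁻¹ / 4 := by
  unfold momentDensity equilibriumDensity
  have hz := rate_pos z
  have hx := rate_pos x
  field_simp
  ring

theorem memLp_momentDensity (n : ℕ) :
    MemLp (Function.uncurry (momentDensity n)) 2 (equilibrium.prod equilibrium) := by
  refine (memLp_two_iff_integrable_sq
    (measurable_momentDensity n).aestronglyMeasurable).2 (integrable_equilibrium_prod_iff.2 ?_)
  have hconv : Integrable fun z : ℝ × ℝ =>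
      ((z.2 - z.1) ^ n * phononSpectrum (z.2 - z.1)) ^ 2 * (rate z.1)⁻¹ := by
    refine (integrable_inv_rate.convolution_integrand (ContinuousLinearMap.mul ℝ ℝ)
      (integrable_pow_mul_phononSpectrum_sq n)).swap.congr (Eventually.of_forall fun z => ?_)
    simp [mul_comm]
  refine (hconv.mul_const (6 * Real.exp 1 / 4)).mono' (by fun_prop)
    (Eventually.of_forall fun z => ?_)
  have h1 := inv_nonneg.2 (rate_pos z.1).le
  have h2 := inv_nonneg.2 (rate_pos z.2).le
  change ‖momentDensity n z.1 z.2 ^ 2 * _‖ ≤ _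
  rw [momentDensity_sq_mul_equilibriumDensity, Real.norm_of_nonneg (by positivity), mul_div_assoc]
  gcongr
  exact inv_rate_le_const z.2

theorem isMarkovDensity_momentDensity_zero : IsMarkovDensity (momentDensity 0) equilibrium where
  memLp := memLp_momentDensity 0
  symm x y := by rw [momentDensity_swap, pow_zero, one_mul]
  nonneg x y := by
    have := phononSpectrum_nonneg (y - x)
    have := rate_pos x
    have := rate_pos y
    unfold momentDensity
    positivity
  pos := by
    refine (Measure.ae_prod_iff_ae_ae (measurableSet_lt measurable_const
      (measurable_momentDensity 0))).2 (Eventually.of_forall fun x => ?_)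
    rw [ae_equilibrium]
    filter_upwards [Measure.ae_ne volume x] with y hy
    have := phononSpectrum_pos (sub_ne_zero.2 hy)
    have := rate_pos x
    have := rate_pos y
    simp only [momentDensity, pow_zero, one_mul]
    positivity
  integral_eq_one x := by
    simp only [integral_equilibrium, momentDensity_mul_equilibriumDensity, pow_zero, one_mul]
    rw [integral_div, integral_sub_right_eq_self (kbar x), ← rate, div_self (rate_pos x).ne']

/-- The scattering operator weighted with the `n`-th power of the energy transfer. -/
def momentOperator (n : ℕ) : Lp ℝ 2 equilibrium →L[ℝ] Lp ℝ 2 equilibrium :=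
  hsOperator (memLp_momentDensity n)

theorem coeFn_momentOperator (n : ℕ) (φ : Lp ℝ 2 equilibrium) :
    momentOperator n φ =ᵐ[equilibrium] fun x =>
      (∫ z, (z - x) ^ n * kbar x (z - x) * φ z) / rate x := by
  filter_upwards [coeFn_hsOperator (memLp_momentDensity n) φ] with x hx
  rw [momentOperator, hx, integral_equilibrium, ← integral_div]
  refine integral_congr_ae (Eventually.of_forall fun z => ?_)
  simp only [mul_right_comm _ (φ z), momentDensity_mul_equilibriumDensity]
  ring

theorem coeFn_momentOperator_one (n : ℕ) :
    momentOperator n (Lp.const 2 equilibrium (1 : ℝ)) =ᵐ[equilibrium] fun x =>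
      (∫ y, y ^ n * kbar x y) / rate x := by
  filter_upwards [coeFn_momentOperator n (Lp.const 2 equilibrium (1 : ℝ))] with x hx
  rw [hx, ← integral_sub_right_eq_self (fun y => y ^ n * kbar x y) x]
  congr 1
  refine integral_congr_ae ?_
  have hone := Lp.coeFn_const (p := 2) (μ := equilibrium) (1 : ℝ)
  rw [EventuallyEq, ae_equilibrium] at hone
  filter_upwards [hone] with z hz
  rw [hz, Function.const_apply, mul_one]

theorem inner_momentOperator_left (n : ℕ) (φ ψ : Lp ℝ 2 equilibrium) :
    ⟪momentOperator n φ, ψ⟫ = (-1) ^ n * ⟪φ, momentOperator n ψ⟫ :=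
  inner_hsOperator_left _ (momentDensity_swap n) φ ψ

/-- Reflection of the energy. -/
def reflection : Lp ℝ 2 equilibrium →ₗᵢ[ℝ] Lp ℝ 2 equilibrium :=
  Lp.compMeasurePreservingₗᵢ ℝ (fun x => -x) measurePreserving_neg_equilibrium

theorem coeFn_reflection (φ : Lp ℝ 2 equilibrium) :
    reflection φ =ᵐ[equilibrium] fun x => φ (-x) :=
  Lp.coeFn_compMeasurePreserving φ measurePreserving_neg_equilibrium

theorem reflection_momentOperator (n : ℕ) (φ : Lp ℝ 2 equilibrium) :
    reflection (momentOperator n φ) = (-1 : ℝ) ^ n • momentOperator n (reflection φ) :=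
  hsOperator_compMeasurePreserving (e := MeasurableEquiv.neg ℝ) _
    measurePreserving_neg_equilibrium (momentDensity_neg_neg n) φ

theorem inner_pos_of_ae_pos {X : Type*} [MeasurableSpace X] {μ : Measure X} [NeZero μ]
    {φ ψ : Lp ℝ 2 μ} (hφ : ∀ᵐ x ∂μ, 0 < φ x) (hψ : ∀ᵐ x ∂μ, 0 < ψ x) : 0 < ⟪φ, ψ⟫ := by
  rw [L2.inner_def]
  refine integral_pos_of_ae_pos (L2.integrable_inner φ ψ) ?_
  filter_upwards [hφ, hψ] with x hφx hψx
  exact mul_pos hψx hφx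

theorem ae_one_pos : ∀ᵐ x ∂equilibrium, 0 < Lp.const 2 equilibrium (1 : ℝ) x :=
  (Lp.coeFn_const (p := 2) (μ := equilibrium) (1 : ℝ)).mono fun x hx => by rw [hx]; exact one_pos

theorem inner_one_momentOperator_two_pos :
    0 < ⟪Lp.const 2 equilibrium (1 : ℝ), momentOperator 2 (Lp.const 2 equilibrium 1)⟫ := by
  refine inner_pos_of_ae_pos ae_one_pos ?_
  filter_upwards [coeFn_momentOperator_one 2] with x hx
  rw [hx]
  refine div_pos (integral_pos_of_ae_pos (integrable_pow_mul_kbar 2 x) ?_) (rate_pos x)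
  filter_upwards [Measure.ae_ne volume (0 : ℝ)] with y hy
  exact mul_pos (by positivity) (kbar_pos hy x)

theorem memLp_div_rate (c : ℝ) : MemLp (fun x => c / rate x) 2 equilibrium :=
  MemLp.of_bound (measurable_const.div measurable_rate).aestronglyMeasurable
    (|c| * (6 * Real.exp 1)) <| Eventually.of_forall fun x => by
    rw [div_eq_mul_inv, norm_mul, Real.norm_of_nonneg (inv_nonneg.2 (rate_pos x).le)]
    exact mul_le_mul_of_nonneg_left (inv_rate_le_const x) (abs_nonneg c)

theorem reflection_toLp {f : ℝ → ℝ} (hf : MemLp f 2 equilibrium) (heven : ∀ x, f (-x) = f x) :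
    reflection hf.toLp = hf.toLp := by
  refine (Lp.toLp_compMeasurePreserving hf measurePreserving_neg_equilibrium).trans ?_
  exact MemLp.toLp_congr _ _ (Eventually.of_forall heven)

/-- The integral equation in the variable `x = ε / T`. In `LowTemperatureModel.pencil`, the terms
`T • A` and `T² • B` correspond to the kernels `K₁` and `K₂`, and `q` to `T³ / Γ₀`. -/
def phononModel (εF : ℝ) {ω₀ : ℝ} (hω₀ : 0 < ω₀) : LowTemperatureModel (Lp ℝ 2 equilibrium) where
  toGappedOperator := isMarkovDensity_momentDensity_zero.gappedOperator
  A := (1 / (2 * εF)) • momentOperator 1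
  B := (1 / (2 * ω₀ ^ 2)) • momentOperator 2
  N := reflection
  q := (memLp_div_rate (ω₀ ^ 2)).toLp
  A_antisymm φ ψ := by
    simp [inner_smul_left, inner_smul_right, inner_momentOperator_left]
  N_K φ := by
    have h := reflection_momentOperator 0 φ
    rwa [pow_zero, one_smul] at h
  N_A φ := by
    simp [reflection_momentOperator]
  N_B φ := by
    simp [reflection_momentOperator]
  N_v := reflection_toLp (memLp_const 1) fun _ => rfl
  N_q := reflection_toLp (memLp_div_rate _) fun x => by rw [rate_neg]
  B_pos := by
    have := inner_one_momentOperator_two_pos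
    rw [smul_apply, inner_smul_right]
    exact mul_pos (by positivity) this
  q_pos := by
    refine inner_pos_of_ae_pos ae_one_pos ?_
    filter_upwards [(memLp_div_rate (ω₀ ^ 2)).coeFn_toLp] with x hx
    have := rate_pos x
    rw [hx]
    positivity

theorem momentOperator_one_ne_zero :
    momentOperator 1 (Lp.const 2 equilibrium (1 : ℝ)) ≠ 0 := by
  intro hzero
  have hae := coeFn_momentOperator_one 1
  rw [hzero, EventuallyEq, ae_equilibrium] at hae
  have hvanish : ∀ᵐ x, ¬ (0 : ℝ) < x := by
    have h0 := Lp.coeFn_zero ℝ 2 equilibrium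
    rw [EventuallyEq, ae_equilibrium] at h0
    filter_upwards [hae, h0] with x hx h0x hpos
    rw [h0x, eq_comm, Pi.zero_apply, div_eq_zero_iff] at hx
    simp only [pow_one] at hx
    exact hx.elim (integral_mul_kbar_neg hpos).ne (rate_pos x).ne'
  simp [ae_iff, Set.Ioi_def] at hvanish

theorem oddResponse_phononModel_ne_zero {εF ω₀ : ℝ} (hεF : εF ≠ 0) (hω₀ : 0 < ω₀) :
    (phononModel εF hω₀).oddResponse ≠ 0 := by
  intro hzero
  have h := (phononModel εF hω₀).oddResponse_sub
  rw [hzero, map_zero, sub_zero, eq_comm] at h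
  exact smul_ne_zero (one_div_ne_zero (mul_ne_zero two_ne_zero hεF)) momentOperator_one_ne_zero h

end Scattering

/-! ### The space `L²_σ` in dimensionless variables -/

section Scaling

variable {ω₀ T : ℝ}

theorem Γ₀_eq (hT : 0 < T) (ω₀ ε : ℝ) : Γ₀ ω₀ T ε = (T / ω₀) ^ 2 * (T * rate (ε / T)) := by
  simp only [Γ₀, Kbar₀]
  rw [integral_const_mul, integral_sub_right_eq_self (fun u => kbar (ε / T) (u / T)) ε,
    Measure.integral_comp_div, abs_of_pos hT, smul_eq_mul, rate]

theorem Γ₀_pos (hω₀ : 0 < ω₀) (hT : 0 < T) (ε : ℝ) : 0 < Γ₀ ω₀ T ε := by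
  have := rate_pos (ε / T)
  rw [Γ₀_eq hT]
  positivity

theorem weight_mul_Γ₀ (hT : 0 < T) (ω₀ ε : ℝ) :
    weight T ε * Γ₀ ω₀ T ε = T ^ 3 / ω₀ ^ 2 * equilibriumDensity (ε / T) := by
  rw [Γ₀_eq hT, weight_eq, equilibriumDensity]
  ring

theorem σ_eq_smul_map_equilibrium (hT : 0 < T) (ω₀ : ℝ) :
    σ ω₀ T = ENNReal.ofReal (T ^ 4 / ω₀ ^ 2) • equilibrium.map (T * ·) := by
  have hmap := map_withDensity_comp (μ := (volume : Measure ℝ)) (measurable_const_mul T)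
    (g := fun ε => ENNReal.ofReal (equilibriumDensity (ε / T))) (by fun_prop)
  simp only [Function.comp_def, mul_div_cancel_left₀ _ hT.ne'] at hmap
  rw [equilibrium, hmap, Real.map_volume_mul_left hT.ne', withDensity_smul_measure, smul_smul,
    ← withDensity_smul _ (by fun_prop), σ, abs_of_pos (inv_pos.2 hT)]
  congr 1
  funext ε
  rw [weight_mul_Γ₀ hT, Pi.smul_apply, smul_eq_mul, ← ENNReal.ofReal_mul (by positivity),
    ← ENNReal.ofReal_mul (by positivity)]
  congr 2
  field_simp

theorem memLp_smul_measure_iff {X E : Type*} [MeasurableSpace X] [NormedAddCommGroup E]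
    {μ : Measure X} {p c : ℝ≥0∞} {f : X → E} (h0 : c ≠ 0) (htop : c ≠ ∞) :
    MemLp f p (c • μ) ↔ MemLp f p μ := by
  refine ⟨fun h => ?_, fun h => h.smul_measure htop⟩
  have h' := h.smul_measure (ENNReal.inv_ne_top.2 h0)
  rwa [smul_smul, ENNReal.inv_mul_cancel h0 htop, one_smul] at h'

theorem memLp_σ_iff (hω₀ : 0 < ω₀) (hT : 0 < T) {φ : ℝ → ℝ} :
    MemLp φ 2 (σ ω₀ T) ↔ MemLp (fun x => φ (T * x)) 2 equilibrium := by
  have hc : ENNReal.ofReal (T ^ 4 / ω₀ ^ 2) ≠ 0 :=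
    (ENNReal.ofReal_pos.2 (by positivity)).ne'
  rw [σ_eq_smul_map_equilibrium hT, memLp_smul_measure_iff hc ENNReal.ofReal_ne_top,
    (measurableEmbedding_mulLeft₀ hT.ne').memLp_map_measure_iff]
  rfl

theorem eLpNorm_σ (hω₀ : 0 < ω₀) (hT : 0 < T) (φ : ℝ → ℝ) :
    eLpNorm φ 2 (σ ω₀ T) =
      ENNReal.ofReal (T ^ 2 / ω₀) * eLpNorm (fun x => φ (T * x)) 2 equilibrium := by
  have hroot : (T ^ 4 / ω₀ ^ 2) ^ (1 / 2 : ℝ) = T ^ 2 / ω₀ := by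
    rw [← Real.sqrt_eq_rpow, show T ^ 4 / ω₀ ^ 2 = (T ^ 2 / ω₀) ^ 2 by ring,
      Real.sqrt_sq (by positivity)]
  rw [σ_eq_smul_map_equilibrium hT, eLpNorm_smul_measure_of_ne_top ENNReal.ofNat_ne_top,
    (measurableEmbedding_mulLeft₀ hT.ne').eLpNorm_map_measure, smul_eq_mul]
  simp only [ENNReal.toReal_div, ENNReal.toReal_one, ENNReal.toReal_ofNat]
  rw [ENNReal.ofReal_rpow_of_pos (by positivity), hroot]
  rfl

theorem ae_equilibrium_mul_iff (hT : 0 < T) {p : ℝ → Prop} :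
    (∀ᵐ x ∂equilibrium, p (T * x)) ↔ ∀ᵐ ε, p ε := by
  rw [ae_equilibrium, ← (measurableEmbedding_mulLeft₀ hT.ne').ae_map_iff,
    Real.map_volume_mul_left hT.ne', Measure.ae_ennreal_smul_measure_iff]
  simpa using hT.ne'

/-- `X` is the class of the function `φ` in the variable `x = ε / T`. -/
def Represents (T : ℝ) (φ : ℝ → ℝ) (X : Lp ℝ 2 equilibrium) : Prop :=
  (fun x => φ (T * x)) =ᵐ[equilibrium] X

section

variable {φ ψ : ℝ → ℝ} {X Y : Lp ℝ 2 equilibrium}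

theorem exists_represents (hω₀ : 0 < ω₀) (hT : 0 < T) (hφ : MemLp φ 2 (σ ω₀ T)) :
    ∃ X, Represents T φ X :=
  ⟨((memLp_σ_iff hω₀ hT).1 hφ).toLp, (MemLp.coeFn_toLp _).symm⟩

theorem represents_comp_div (hT : 0 < T) (X : Lp ℝ 2 equilibrium) :
    Represents T (fun ε => X (ε / T)) X :=
  Eventually.of_forall fun x => by simp only [mul_div_cancel_left₀ x hT.ne']

theorem represents_const (T c : ℝ) :
    Represents T (fun _ => c) (c • Lp.const 2 equilibrium (1 : ℝ)) := by
  filter_upwards [Lp.coeFn_smul c (Lp.const 2 equilibrium (1 : ℝ)),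
    Lp.coeFn_const (p := 2) (μ := equilibrium) (1 : ℝ)] with x hsmul hone
  rw [hsmul, Pi.smul_apply, hone, Function.const_apply, smul_eq_mul, mul_one]

namespace Represents

theorem memLp (hX : Represents T φ X) (hω₀ : 0 < ω₀) (hT : 0 < T) : MemLp φ 2 (σ ω₀ T) :=
  (memLp_σ_iff hω₀ hT).2 ((memLp_congr_ae hX).2 (Lp.memLp X))

theorem eLpNorm_eq (hX : Represents T φ X) (hω₀ : 0 < ω₀) (hT : 0 < T) :
    eLpNorm φ 2 (σ ω₀ T) = ENNReal.ofReal (T ^ 2 / ω₀ * ‖X‖) := by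
  rw [eLpNorm_σ hω₀ hT, eLpNorm_congr_ae hX, ENNReal.ofReal_mul (by positivity), ofReal_norm,
    Lp.enorm_def]

theorem eq_iff (hX : Represents T φ X) (hY : Represents T ψ Y) (hT : 0 < T) :
    (∀ᵐ ε, φ ε = ψ ε) ↔ X = Y := by
  rw [← ae_equilibrium_mul_iff hT, Lp.ext_iff]
  exact ⟨fun h => hX.symm.trans (EventuallyEq.trans h hY), fun h => hX.trans (h.trans hY.symm)⟩

theorem add (hX : Represents T φ X) (hY : Represents T ψ Y) :
    Represents T (fun ε => φ ε + ψ ε) (X + Y) :=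
  (EventuallyEq.add hX hY).trans (Lp.coeFn_add X Y).symm

theorem sub (hX : Represents T φ X) (hY : Represents T ψ Y) :
    Represents T (fun ε => φ ε - ψ ε) (X - Y) :=
  (EventuallyEq.sub hX hY).trans (Lp.coeFn_sub X Y).symm

theorem const_mul (hX : Represents T φ X) (c : ℝ) : Represents T (fun ε => c * φ ε) (c • X) :=
  (EventuallyEq.const_smul hX c).trans (Lp.coeFn_smul c X).symm

theorem sum {ι : Type*} (s : Finset ι) {f : ι → ℝ → ℝ} {F : ι → Lp ℝ 2 equilibrium}
    (h : ∀ i ∈ s, Represents T (f i) (F i)) :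
    Represents T (fun ε => ∑ i ∈ s, f i ε) (∑ i ∈ s, F i) := by
  classical
  induction s using Finset.induction_on with
  | empty => simpa using represents_const T 0
  | insert i s hi ih =>
    simp only [Finset.sum_insert hi]
    exact (h i (Finset.mem_insert_self i s)).add (ih fun j hj => h j (Finset.mem_insert_of_mem hj))

theorem comp_neg (hX : Represents T φ X) : Represents T (fun ε => φ (-ε)) (reflection X) := by
  filter_upwards [coeFn_reflection X,
    measurePreserving_neg_equilibrium.quasiMeasurePreserving.ae hX] with x hx hneg
  rw [hx, ← hneg, mul_neg]

theorem ae_odd_iff (hX : Represents T φ X) (hT : 0 < T) :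
    (∀ᵐ ε, φ (-ε) = -φ ε) ↔ reflection X = -X := by
  simpa using hX.comp_neg.eq_iff (hX.const_mul (-1)) hT

theorem isOddL2_iff (hX : Represents T φ X) (hω₀ : 0 < ω₀) (hT : 0 < T) :
    IsOddL2 ω₀ T φ ↔ reflection X = -X := by
  rw [IsOddL2, and_iff_right (hX.memLp hω₀ hT), hX.ae_odd_iff hT]

theorem evenPart (hX : Represents T φ X) :
    Represents T (evenPart φ) ((1 / 2 : ℝ) • (X + reflection X)) := by
  convert (hX.add hX.comp_neg).const_mul (1 / 2) using 2 with ε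
  rw [ElectronPhonon.evenPart]
  ring

theorem oddPart (hX : Represents T φ X) :
    Represents T (oddPart φ) ((1 / 2 : ℝ) • (X - reflection X)) := by
  convert (hX.sub hX.comp_neg).const_mul (1 / 2) using 2 with ε
  rw [ElectronPhonon.oddPart]
  ring

end Represents

end

end Scaling

/-! ### The integral operators -/

section Operators

variable {ω₀ εF T : ℝ}

/-- The kernel `K₀` weighted with the `n`-th power of the energy transfer. Up to a factor
proportional to `Tⁿ`, it is `Kₙ` for `n = 0, 1, 2`. -/
def momentKernel (n : ℕ) (ω₀ T ε u : ℝ) : ℝ := ((u - ε) / T) ^ n * K₀ ω₀ T ε u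

theorem K₀_eq_momentKernel (ω₀ T : ℝ) : K₀ ω₀ T = momentKernel 0 ω₀ T := by
  funext ε u
  rw [momentKernel, pow_zero, one_mul]

theorem K₁_eq_momentKernel (hω₀ : 0 < ω₀) (εF T ε u : ℝ) :
    K₁ ω₀ εF T ε u = T / (2 * εF) * momentKernel 1 ω₀ T ε u := by
  have hcancel : ω₀ / (2 * εF) * (T / ω₀) = T / (2 * εF) := by field_simp
  rw [K₁, Kbar₁, momentKernel, K₀, hcancel]
  ring

theorem K₂_eq_momentKernel (ω₀ T ε u : ℝ) :
    K₂ ω₀ T ε u = T ^ 2 / (2 * ω₀ ^ 2) * momentKernel 2 ω₀ T ε u := by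
  rw [K₂, Kbar₂, momentKernel, K₀]
  ring

theorem momentKernel_mul_mul (hω₀ : 0 < ω₀) (hT : 0 < T) (n : ℕ) (x z : ℝ) :
    momentKernel n ω₀ T (T * x) (T * z) =
      T⁻¹ * (momentDensity n x z * equilibriumDensity z) := by
  have hx := rate_pos x
  rw [momentDensity_mul_equilibriumDensity, momentKernel, K₀, Γ₀_eq hT, Kbar₀, ← mul_sub,
    mul_div_cancel_left₀ x hT.ne', mul_div_cancel_left₀ _ hT.ne']
  field_simp

theorem intOp_momentKernel_mul (hω₀ : 0 < ω₀) (hT : 0 < T) (n : ℕ) (φ : ℝ → ℝ) (x : ℝ) :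
    intOp (momentKernel n ω₀ T) φ (T * x) =
      ∫ z, momentDensity n x z * φ (T * z) ∂equilibrium := by
  have hscale := Measure.integral_comp_mul_left (fun u => momentKernel n ω₀ T (T * x) u * φ u) T
  rw [abs_of_pos (inv_pos.2 hT), eq_comm, inv_smul_eq_iff₀ hT.ne', smul_eq_mul,
    ← integral_const_mul] at hscale
  rw [intOp, hscale, integral_equilibrium]
  congr 1
  funext z
  rw [momentKernel_mul_mul hω₀ hT]
  field_simp

theorem integral_K₀ (hω₀ : 0 < ω₀) (hT : 0 < T) (ε : ℝ) : ∫ u, K₀ ω₀ T ε u = 1 := by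
  simp only [K₀]
  rw [integral_div, ← Γ₀, div_self (Γ₀_pos hω₀ hT ε).ne']

theorem C₀_eq (hω₀ : 0 < ω₀) (hT : 0 < T) {φ : ℝ → ℝ} {ε : ℝ} (hK : Integrable (K₀ ω₀ T ε))
    (hφ : Integrable fun u => K₀ ω₀ T ε u * φ u) :
    C₀ ω₀ T φ ε = intOp (K₀ ω₀ T) φ ε - φ ε := by
  rw [C₀, integral_add_right_eq_self (fun u => K₀ ω₀ T ε u * (φ u - φ ε)) ε, intOp]
  simp only [mul_sub]
  rw [integral_sub hφ (hK.mul_const (φ ε)), integral_mul_const, integral_K₀ hω₀ hT, one_mul]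

theorem Γ₁_div_Γ₀_eq (ω₀ εF T ε : ℝ) :
    Γ₁ ω₀ εF T ε / Γ₀ ω₀ T ε = intOp (K₁ ω₀ εF T) (fun _ => 1) ε := by
  simp only [intOp, K₁, mul_one]
  rw [integral_div, Γ₁]

theorem represents_inv_Γ₀ (hω₀ : 0 < ω₀) (hT : 0 < T) :
    Represents T (fun ε => 1 / Γ₀ ω₀ T ε) ((T ^ 3)⁻¹ • (phononModel εF hω₀).q) := by
  filter_upwards [Lp.coeFn_smul (T ^ 3)⁻¹ (phononModel εF hω₀).q,
    (memLp_div_rate (ω₀ ^ 2)).coeFn_toLp] with x hsmul hq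
  have := rate_pos x
  rw [hsmul, Pi.smul_apply, phononModel, hq, Γ₀_eq hT, mul_div_cancel_left₀ x hT.ne', smul_eq_mul]
  field_simp

namespace Represents

variable {φ : ℝ → ℝ} {X : Lp ℝ 2 equilibrium}

theorem intOp_momentKernel (hX : Represents T φ X) (hω₀ : 0 < ω₀) (hT : 0 < T) (n : ℕ) :
    Represents T (intOp (momentKernel n ω₀ T) φ) (momentOperator n X) := by
  filter_upwards [coeFn_hsOperator (memLp_momentDensity n) X] with x hx
  rw [momentOperator, hx, intOp_momentKernel_mul hω₀ hT]
  exact integral_congr_ae (hX.mono fun z hz => by simp only [hz])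

theorem ae_integrable_momentKernel (hX : Represents T φ X) (hω₀ : 0 < ω₀) (hT : 0 < T) (n : ℕ) :
    ∀ᵐ x ∂equilibrium, Integrable fun u => momentKernel n ω₀ T (T * x) u * φ u := by
  filter_upwards [ae_memLp_section (memLp_momentDensity n)] with x hx
  have hint : Integrable (fun z => momentDensity n x z * φ (T * z)) equilibrium :=
    (hx.integrable_mul (Lp.memLp X)).congr (hX.mono fun z hz => by simp [hz])
  rw [← integrable_comp_mul_left_iff _ hT.ne']
  refine ((integrable_equilibrium_iff.1 hint).const_mul T⁻¹).congr
    (Eventually.of_forall fun z => ?_)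
  simp only [momentKernel_mul_mul hω₀ hT]
  ring

theorem intOp_K₀ (hX : Represents T φ X) (hω₀ : 0 < ω₀) (hT : 0 < T) :
    Represents T (intOp (K₀ ω₀ T) φ) (momentOperator 0 X) := by
  rw [K₀_eq_momentKernel]
  exact hX.intOp_momentKernel hω₀ hT 0

theorem intOp_K₁ (hX : Represents T φ X) (hω₀ : 0 < ω₀) (hT : 0 < T) :
    Represents T (intOp (K₁ ω₀ εF T) φ) (T • (phononModel εF hω₀).A X) := by
  convert (hX.intOp_momentKernel hω₀ hT 1).const_mul (T / (2 * εF)) using 1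
  · funext ε
    simp only [intOp, K₁_eq_momentKernel hω₀, mul_assoc]
    exact integral_const_mul _ _
  · rw [div_eq_mul_one_div, mul_smul]
    rfl

theorem intOp_K₂ (hX : Represents T φ X) (hω₀ : 0 < ω₀) (hT : 0 < T) :
    Represents T (intOp (K₂ ω₀ T) φ) (T ^ 2 • (phononModel εF hω₀).B X) := by
  convert (hX.intOp_momentKernel hω₀ hT 2).const_mul (T ^ 2 / (2 * ω₀ ^ 2)) using 1
  · funext ε
    simp only [intOp, K₂_eq_momentKernel, mul_assoc]
    exact integral_const_mul _ _
  · rw [div_eq_mul_one_div, mul_smul]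
    rfl

theorem intOp_Kfull (hX : Represents T φ X) (hω₀ : 0 < ω₀) (hT : 0 < T) :
    Represents T (intOp (Kfull ω₀ εF T) φ) ((phononModel εF hω₀).K X +
      T • (phononModel εF hω₀).A X - T ^ 2 • (phononModel εF hω₀).B X) := by
  refine EventuallyEq.trans ?_
    (((hX.intOp_K₀ hω₀ hT).add (hX.intOp_K₁ hω₀ hT)).sub (hX.intOp_K₂ hω₀ hT))
  filter_upwards [hX.ae_integrable_momentKernel hω₀ hT 0, hX.ae_integrable_momentKernel hω₀ hT 1,
    hX.ae_integrable_momentKernel hω₀ hT 2] with x h₀ h₁ h₂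
  have h₁' := h₁.const_mul (T / (2 * εF))
  have h₂' := h₂.const_mul (T ^ 2 / (2 * ω₀ ^ 2))
  simp only [← mul_assoc, ← K₀_eq_momentKernel, ← K₁_eq_momentKernel hω₀,
    ← K₂_eq_momentKernel] at h₀ h₁' h₂'
  have h₀₁ : Integrable fun u => K₀ ω₀ T (T * x) u * φ u + K₁ ω₀ εF T (T * x) u * φ u := h₀.add h₁'
  simp only [intOp, Kfull, sub_mul, add_mul]
  rw [integral_sub h₀₁ h₂', integral_add h₀ h₁']

theorem C₀ (hX : Represents T φ X) (hω₀ : 0 < ω₀) (hT : 0 < T) :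
    Represents T (C₀ ω₀ T φ) (momentOperator 0 X - X) := by
  refine EventuallyEq.trans ?_ ((hX.intOp_K₀ hω₀ hT).sub hX)
  filter_upwards [hX.ae_integrable_momentKernel hω₀ hT 0,
    (represents_const T 1).ae_integrable_momentKernel hω₀ hT 0] with x hφ hone
  rw [← K₀_eq_momentKernel] at hφ hone
  exact C₀_eq hω₀ hT (by simpa only [mul_one] using hone) hφ

theorem iterate_intOp_K₀ (hX : Represents T φ X) (hω₀ : 0 < ω₀) (hT : 0 < T) (n : ℕ) :
    Represents T ((intOp (K₀ ω₀ T))^[n] φ) ((momentOperator 0 ^ n) X) := by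
  induction n with
  | zero => simpa using hX
  | succ n ih =>
    rw [Function.iterate_succ_apply', pow_succ', mul_apply_eq_comp]
    exact ih.intOp_K₀ hω₀ hT

theorem hasNeumannSum {S : ℝ → ℝ} {Y : Lp ℝ 2 equilibrium} (hX : Represents T φ X)
    (hS : Represents T S Y) (hω₀ : 0 < ω₀) (hT : 0 < T)
    (hsum : HasSum (fun n => (momentOperator 0 ^ n) X) Y) : HasNeumannSum ω₀ T φ S := by
  refine ⟨fun n => (hX.iterate_intOp_K₀ hω₀ hT n).memLp hω₀ hT, hS.memLp hω₀ hT, ?_⟩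
  have hnorm (n : ℕ) :=
    ((Represents.sum (Finset.range n) fun m _ => hX.iterate_intOp_K₀ hω₀ hT m).sub hS).eLpNorm_eq
      hω₀ hT
  simp only [hnorm]
  have hlim := ((hsum.tendsto_sum_nat.sub_const Y).norm).const_mul (T ^ 2 / ω₀)
  rw [sub_self, norm_zero, mul_zero] at hlim
  simpa using ENNReal.tendsto_ofReal hlim

theorem isSolution_iff (hX : Represents T φ X) (hω₀ : 0 < ω₀) (hT : 0 < T) :
    IsSolution ω₀ εF T φ ↔
      (phononModel εF hω₀).pencil T (T ^ 3 • X) = (phononModel εF hω₀).q := by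
  set m := phononModel εF hω₀
  have hpencil : m.pencil T X = X - (m.K X + T • m.A X - T ^ 2 • m.B X) := by
    rw [m.pencil_apply]
    abel
  rw [IsSolution, and_iff_right (hX.memLp hω₀ hT),
    hX.eq_iff ((represents_inv_Γ₀ hω₀ hT).add (hX.intOp_Kfull hω₀ hT)) hT, map_smul,
    ← eq_inv_smul_iff₀ (pow_ne_zero 3 hT.ne'), hpencil, sub_eq_iff_eq_add]

end Represents

end Operators

/-! ### The odd part of the solution -/

section OddPart

variable {ω₀ εF T : ℝ}

theorem exists_hasNeumannSum (hω₀ : 0 < ω₀) (hT : 0 < T) {f : ℝ → ℝ} (hf : IsOddL2 ω₀ T f) :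
    ∃ S, HasNeumannSum ω₀ T f S := by
  obtain ⟨X, hX⟩ := exists_represents hω₀ hT hf.1
  have hodd := (hX.isOddL2_iff hω₀ hT).1 hf
  exact ⟨_, hX.hasNeumannSum (represents_comp_div hT _) hω₀ hT
    ((phononModel 0 hω₀).hasSum_neumann ((phononModel 0 hω₀).inner_v_eq_zero_of_odd hodd))⟩

/-- The sum `S_T` of the Neumann series of `Γ₁ / Γ₀`. -/
def oddResponse (εF : ℝ) (hω₀ : 0 < ω₀) (T : ℝ) : ℝ → ℝ :=
  fun ε => (T • (phononModel εF hω₀).oddResponse : Lp ℝ 2 equilibrium) (ε / T)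

theorem represents_oddResponse (εF : ℝ) (hω₀ : 0 < ω₀) (hT : 0 < T) :
    Represents T (oddResponse εF hω₀ T) (T • (phononModel εF hω₀).oddResponse) :=
  represents_comp_div hT _

theorem represents_Γ₁_div_Γ₀ (εF : ℝ) (hω₀ : 0 < ω₀) (hT : 0 < T) :
    Represents T (fun ε => Γ₁ ω₀ εF T ε / Γ₀ ω₀ T ε)
      (T • (phononModel εF hω₀).A (phononModel εF hω₀).v) := by
  have h := (represents_const T 1).intOp_K₁ (εF := εF) hω₀ hT
  simp only [Γ₁_div_Γ₀_eq]
  rwa [one_smul] at h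

theorem isOddL2_Γ₁_div_Γ₀ (εF : ℝ) (hω₀ : 0 < ω₀) (hT : 0 < T) :
    IsOddL2 ω₀ T fun ε => Γ₁ ω₀ εF T ε / Γ₀ ω₀ T ε := by
  rw [(represents_Γ₁_div_Γ₀ εF hω₀ hT).isOddL2_iff hω₀ hT, map_smul, ← smul_neg]
  exact congrArg (T • ·) (phononModel εF hω₀).N_A_v

theorem isOddL2_oddResponse (εF : ℝ) (hω₀ : 0 < ω₀) (hT : 0 < T) :
    IsOddL2 ω₀ T (oddResponse εF hω₀ T) := by
  rw [(represents_oddResponse εF hω₀ hT).isOddL2_iff hω₀ hT, map_smul, ← smul_neg]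
  exact congrArg (T • ·) (phononModel εF hω₀).N_oddResponse

theorem hasNeumannSum_oddResponse (εF : ℝ) (hω₀ : 0 < ω₀) (hT : 0 < T) :
    HasNeumannSum ω₀ T (fun ε => Γ₁ ω₀ εF T ε / Γ₀ ω₀ T ε) (oddResponse εF hω₀ T) := by
  refine (represents_Γ₁_div_Γ₀ εF hω₀ hT).hasNeumannSum (represents_oddResponse εF hω₀ hT) hω₀ hT ?_
  simp only [map_smul]
  exact ((phononModel εF hω₀).hasSum_neumann (phononModel εF hω₀).inner_v_A_v).const_smul T

theorem C₀_eq_neg_intOp_K₁_iff (hω₀ : 0 < ω₀) (hT : 0 < T) {ψ : ℝ → ℝ} (hψ : IsOddL2 ω₀ T ψ)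
    (c : ℝ) :
    (∀ᵐ ε, C₀ ω₀ T ψ ε = -intOp (K₁ ω₀ εF T) (fun _ => c) ε) ↔
      ∀ᵐ ε, ψ ε = c * oddResponse εF hω₀ T ε := by
  obtain ⟨X, hX⟩ := exists_represents hω₀ hT hψ.1
  set m := phononModel εF hω₀
  have hXv : ⟪m.v, X⟫ = 0 := m.inner_v_eq_zero_of_odd ((hX.isOddL2_iff hω₀ hT).1 hψ)
  have hsource : ⟪m.v, (c * T) • m.A m.v⟫ = 0 := by
    rw [inner_smul_right, m.inner_v_A_v, mul_zero]
  have hK₁ := ((represents_const T c).intOp_K₁ (εF := εF) hω₀ hT).const_mul (-1)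
  simp only [neg_one_mul, map_smul, smul_comm T c, smul_smul] at hK₁
  rw [(hX.C₀ hω₀ hT).eq_iff hK₁ hT,
    hX.eq_iff ((represents_oddResponse εF hω₀ hT).const_mul c) hT, smul_smul,
    LowTemperatureModel.oddResponse, ← m.neumann_smul, ← m.sub_K_eq_iff hsource hXv, ← neg_sub,
    neg_smul, neg_inj]
  rfl

end OddPart

/-! ### Low temperatures -/

section LowTemperature

variable {ω₀ εF : ℝ} {f g φ : ℝ → ℝ → ℝ}

theorem leadingOrder_iff (hω₀ : 0 < ω₀) {X Y : ℝ → Lp ℝ 2 equilibrium}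
    (hX : ∀ᶠ T in 𝓝[>] 0, Represents T (f T) (X T))
    (hY : ∀ᶠ T in 𝓝[>] 0, Represents T (g T) (Y T)) :
    LeadingOrder ω₀ f g ↔ X ~[𝓝[>] 0] Y := by
  rw [Asymptotics.IsEquivalent, Asymptotics.isLittleO_iff, LeadingOrder]
  refine forall₂_congr fun δ hδ => eventually_congr ?_
  filter_upwards [hX, hY, self_mem_nhdsWithin] with T hXT hYT hT
  replace hT : 0 < T := hT
  have hscale : 0 < T ^ 2 / ω₀ := by positivity
  rw [(hXT.sub hYT).eLpNorm_eq hω₀ hT, hYT.eLpNorm_eq hω₀ hT, ← ENNReal.ofReal_mul hδ.le,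
    ENNReal.ofReal_le_ofReal_iff (by positivity), mul_left_comm, mul_le_mul_iff_right₀ hscale,
    Pi.sub_apply]

theorem eventually_existsUnique_isSolution (εF : ℝ) (hω₀ : 0 < ω₀) :
    ∀ᶠ T in 𝓝[>] 0, ∃ φ, IsSolution ω₀ εF T φ ∧
      ∀ φ', IsSolution ω₀ εF T φ' → ∀ᵐ ε, φ' ε = φ ε := by
  obtain ⟨_, hasymp⟩ := (phononModel εF hω₀).low_temperature_asymptotics
  filter_upwards [hasymp, self_mem_nhdsWithin] with T ⟨hbij, _⟩ hT
  replace hT : 0 < T := hT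
  obtain ⟨Z, hZ⟩ := hbij.2 (phononModel εF hω₀).q
  have hX := represents_comp_div hT ((T ^ 3)⁻¹ • Z)
  have hcancel : T ^ 3 • (T ^ 3)⁻¹ • Z = Z := smul_inv_smul₀ (pow_ne_zero 3 hT.ne') Z
  refine ⟨_, (hX.isSolution_iff hω₀ hT).2 (hcancel.symm ▸ hZ), fun φ' hφ' => ?_⟩
  obtain ⟨Y, hY⟩ := exists_represents hω₀ hT hφ'.1
  rw [hY.eq_iff hX hT, eq_inv_smul_iff₀ (pow_ne_zero 3 hT.ne')]
  exact hbij.1 (((hY.isSolution_iff hω₀ hT).1 hφ').trans hZ.symm)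

theorem exists_represents_isSolution (hω₀ : 0 < ω₀)
    (hφ : ∀ᶠ T in 𝓝[>] 0, IsSolution ω₀ εF T (φ T)) :
    ∃ Z : ℝ → Lp ℝ 2 equilibrium,
      (∀ᶠ T in 𝓝[>] 0, (phononModel εF hω₀).pencil T (Z T) = (phononModel εF hω₀).q) ∧
      ∀ᶠ T in 𝓝[>] 0, Represents T (φ T) ((T ^ 3)⁻¹ • Z T) := by
  have hex : ∀ᶠ T in 𝓝[>] 0, ∃ X, Represents T (φ T) X ∧ 0 < T := by
    filter_upwards [hφ, self_mem_nhdsWithin] with T hφT hT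
    obtain ⟨X, hX⟩ := exists_represents hω₀ hT hφT.1
    exact ⟨X, hX, hT⟩
  obtain ⟨X, hX⟩ := hex.choice
  refine ⟨fun T => T ^ 3 • X T, ?_, ?_⟩
  · filter_upwards [hX, hφ] with T ⟨hXT, hT⟩ hφT
    exact (hXT.isSolution_iff hω₀ hT).1 hφT
  · filter_upwards [hX] with T ⟨hXT, hT⟩
    rwa [inv_smul_smul₀ (pow_ne_zero 3 hT.ne')]

theorem leadingOrder_evenPart (hω₀ : 0 < ω₀) (hφ : ∀ᶠ T in 𝓝[>] 0, IsSolution ω₀ εF T (φ T)) :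
    LeadingOrder ω₀ (fun T => evenPart (φ T))
      fun T _ => (phononModel εF hω₀).leadingCoeff / T ^ 5 := by
  obtain ⟨Z, hZ, hφZ⟩ := exists_represents_isSolution hω₀ hφ
  rw [leadingOrder_iff hω₀ (hφZ.mono fun T => Represents.evenPart)
    (Eventually.of_forall fun T => represents_const T _)]
  convert (Asymptotics.IsEquivalent.refl (u := fun T : ℝ => (T ^ 3)⁻¹)).smul
    ((phononModel εF hω₀).isEquivalent_even hZ) using 2 with T
  · rw [map_smul, ← smul_add, smul_comm]
    rfl
  · rw [smul_smul, ← div_eq_inv_mul, div_div, ← pow_add]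
    rfl

theorem isEquivalent_of_leadingOrder_const (hω₀ : 0 < ω₀) {c p : ℝ → ℝ}
    (hc : LeadingOrder ω₀ f fun T _ => c T) (hp : LeadingOrder ω₀ f fun T _ => p T)
    {X : ℝ → Lp ℝ 2 equilibrium} (hX : ∀ᶠ T in 𝓝[>] 0, Represents T (f T) (X T)) :
    c ~[𝓝[>] 0] p := by
  have hconst (r : ℝ → ℝ) := leadingOrder_iff hω₀ hX
    (Eventually.of_forall fun T => represents_const T (r T))
  exact (isEquivalent_smul_const_iff (phononModel 0 hω₀).v_ne_zero).1
    (((hconst c).1 hc).symm.trans ((hconst p).1 hp))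

theorem leadingOrder_oddPart (hω₀ : 0 < ω₀) (hεF : εF ≠ 0)
    (hφ : ∀ᶠ T in 𝓝[>] 0, IsSolution ω₀ εF T (φ T)) {p : ℝ → ℝ}
    (hp : LeadingOrder ω₀ (fun T => evenPart (φ T)) fun T _ => p T) :
    LeadingOrder ω₀ (fun T => oddPart (φ T)) fun T ε => p T * oddResponse εF hω₀ T ε := by
  obtain ⟨Z, hZ, hφZ⟩ := exists_represents_isSolution hω₀ hφ
  have hcoeff := isEquivalent_of_leadingOrder_const hω₀ (leadingOrder_evenPart hω₀ hφ) hp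
    (hφZ.mono fun T => Represents.evenPart)
  have hresponse : ∀ᶠ T in 𝓝[>] 0, Represents T (fun ε => p T * oddResponse εF hω₀ T ε)
      (p T • T • (phononModel εF hω₀).oddResponse) := by
    filter_upwards [self_mem_nhdsWithin] with T hT
    exact (represents_oddResponse εF hω₀ hT).const_mul (p T)
  rw [leadingOrder_iff hω₀ (hφZ.mono fun T => Represents.oddPart) hresponse]
  refine Asymptotics.IsEquivalent.trans ?_ (hcoeff.smul .refl)
  refine (((Asymptotics.IsEquivalent.refl (u := fun T : ℝ => (T ^ 3)⁻¹)).smul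
    ((phononModel εF hω₀).isEquivalent_odd
      (oddResponse_phononModel_ne_zero hεF hω₀) hZ)).congr_left ?_).congr_right ?_
  · refine Eventually.of_forall fun T => ?_
    simp only
    rw [map_smul, ← smul_sub, smul_comm]
    rfl
  · filter_upwards [self_mem_nhdsWithin] with T (hT : 0 < T)
    rw [smul_smul, smul_smul]
    congr 1
    field_simp

end LowTemperature

end

end ElectronPhonon

theorem proposition3p3 (ω₀ εF : ℝ) (hω₀ : 0 < ω₀) (hεF : 0 < εF) :
    -- the Neumann series converges on odd functions
    (∀ T : ℝ, 0 < T → ∀ f : ℝ → ℝ, IsOddL2 ω₀ T f → ∃ S, HasNeumannSum ω₀ T f S) ∧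
    ∃ S : ℝ → ℝ → ℝ,
      -- `S T` is the sum of the series for `Γ₁/Γ₀`, and `φ₊ S` is the unique odd solution of the
      -- leading-order equation `C₀ φ₋ = - K₁ φ₊` with constant `φ₊`
      (∀ T : ℝ, 0 < T →
        IsOddL2 ω₀ T (fun ε => Γ₁ ω₀ εF T ε / Γ₀ ω₀ T ε) ∧
        HasNeumannSum ω₀ T (fun ε => Γ₁ ω₀ εF T ε / Γ₀ ω₀ T ε) (S T) ∧
        IsOddL2 ω₀ T (S T) ∧
        ∀ (φp : ℝ) (ψ : ℝ → ℝ), IsOddL2 ω₀ T ψ →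
          ((∀ᵐ ε, C₀ ω₀ T ψ ε = -intOp (K₁ ω₀ εF T) (fun _ => φp) ε) ↔
            ∀ᵐ ε, ψ ε = φp * S T ε)) ∧
      -- at low temperature the full integral equation has exactly one solution in `L²_σ`
      ∃ T₀ : ℝ, 0 < T₀ ∧
        (∀ T : ℝ, 0 < T → T < T₀ → ∃ φ, IsSolution ω₀ εF T φ ∧
          ∀ φ', IsSolution ω₀ εF T φ' → ∀ᵐ ε, φ' ε = φ ε) ∧
        ∀ φ : ℝ → ℝ → ℝ, (∀ T : ℝ, 0 < T → T < T₀ → IsSolution ω₀ εF T (φ T)) →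
          -- the even part is to leading order a constant, which scales as `T⁻⁵`
          (∃ C : ℝ, 0 < C ∧
            LeadingOrder ω₀ (fun T => evenPart (φ T)) (fun T _ => C / T ^ 5)) ∧
          -- with that constant `φ₊`, the odd part is to leading order `φ₊ ∑ (K₀)^m (Γ₁/Γ₀)`
          ∀ φp : ℝ → ℝ, LeadingOrder ω₀ (fun T => evenPart (φ T)) (fun T _ => φp T) →
            LeadingOrder ω₀ (fun T => oddPart (φ T)) (fun T ε => φp T * S T ε) := by
  refine ⟨fun T hT f hf => exists_hasNeumannSum hω₀ hT hf, oddResponse εF hω₀,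
    fun T hT => ⟨isOddL2_Γ₁_div_Γ₀ εF hω₀ hT, hasNeumannSum_oddResponse εF hω₀ hT,
      isOddL2_oddResponse εF hω₀ hT, fun φp ψ hψ => C₀_eq_neg_intOp_K₁_iff hω₀ hT hψ φp⟩, ?_⟩
  obtain ⟨T₀, hT₀, hunique⟩ :=
    mem_nhdsGT_iff_exists_Ioo_subset.1 (eventually_existsUnique_isSolution εF hω₀)
  refine ⟨T₀, hT₀, fun T hT hTT₀ => hunique ⟨hT, hTT₀⟩, fun φ hφ => ?_⟩
  have hsol : ∀ᶠ T in 𝓝[>] 0, IsSolution ω₀ εF T (φ T) := by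
    filter_upwards [Ioo_mem_nhdsGT hT₀] with T hT using hφ T hT.1 hT.2
  exact ⟨⟨_, (phononModel εF hω₀).leadingCoeff_pos, leadingOrder_evenPart hω₀ hsol⟩,
    fun φp hp => leadingOrder_oddPart hω₀ hεF.ne' hsol hp⟩
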